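/- A linearized chord diagram with $n$ chords is a partition of $[2n]=\{1,\dots,2n\}$ into $n$ pairs (chords); two chords $\{a,c\}$ and $\{b,d\}$ cross if $a<b<c<d$. A cut of such a diagram is a partition of $[2n]$ into two nonempty blocks $[2n_1]$ and $[2n]\setminus[2n_1]$, $1\le n_1\le n-1$, such that no chord joins points of different blocks. Let $X_{n,m}$ be the number of cuts of a linearized chord diagram chosen uniformly at random among all those with $n$ chords and $m$ crossings. For $|x|<1$ put $$f(x)=\sum_{j\ge 0}(-1)^j x^{\binom{j+1}{2}}.$$ Theorem. Let $m=m(n)$ be nonnegative integers with $m=O(n)$ as $n\to\infty$, and set $q=q_n=\frac{m}{m+n}$ and $p=p_n=1-\frac{1}{2f(q)}$. Then $f(q_n)>\tfrac12$ is bounded away from $\tfrac12$: there is $\delta>0$ with $f(q_n)\ge \tfrac12+\delta$ for all $n\ge 1$. For each fixed $j\ge 0$, as $n\to\infty$, $$\mathrm{P}(X_{n,m}=j)=(j+1)(1-p)^2p^j+o(1).$$ Moreover, $f(x)>\tfrac12$ for every $x\in[0,1)$. Hence $p(x):=1-\frac1{2f(x)}$ lies in $(0,1)$ for such $x$, and $j\mapsto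 (j+1)(1-p(x))^2p(x)^j$ is the distribution of the sum $Y'+Y''$ of two independent geometric random variables with $\mathrm{P}(Y'=i)=\mathrm{P}(Y''=i)=(1-p(x))p(x)^i$, $i\ge 0$; so $X_{n,m}$ is asymptotic in distribution to such a sum with $p=p(q_n)$. -/

import Mathlib

open Filter Topology MeasureTheory ProbabilityTheory Asymptotics

/-- A linearized chord diagram with `n` chords: a partition of the `2 n` points of a line
into `n` pairs, encoded as the fixed-point-free involution that exchanges the two endpoints of
each chord. -/
def LinearizedChordDiagram (n : ℕ) : Type :=
  {σ : Equiv.Perm (Fin (2 * n)) // ∀ i, σ (σ i) = i ∧ σ i ≠ i}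

namespace LinearizedChordDiagram

instance (n : ℕ) : Fintype (LinearizedChordDiagram n) :=
  inferInstanceAs
    (Fintype {σ : Equiv.Perm (Fin (2 * n)) // ∀ i, σ (σ i) = i ∧ σ i ≠ i})

instance (n : ℕ) : MeasurableSpace (LinearizedChordDiagram n) := ⊤

instance (n : ℕ) : DiscreteMeasurableSpace (LinearizedChordDiagram n) :=
  ⟨fun _ => trivial⟩

/-- The number of crossings, that is, of pairs of chords `{a, c}`, `{b, d}` with
`a < b < c < d`. Such a pair is recorded by its two left endpoints `(a, b)`. -/
def crossings {n : ℕ} (D : LinearizedChordDiagram n) : ℕ :=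
  (Finset.univ.filter fun x : Fin (2 * n) × Fin (2 * n) =>
    x.1 < x.2 ∧ x.2 < D.1 x.1 ∧ D.1 x.1 < D.1 x.2).card

/-- The number of cuts, that is, of partitions of the `2 n` points into the (nonempty) block of
the first `2 k` points and the (nonempty) block of the remaining ones such that no chord joins
points from different blocks. -/
def cuts {n : ℕ} (D : LinearizedChordDiagram n) : ℕ :=
  ((Finset.Ioo 0 n).filter fun k : ℕ =>
    ∀ i : Fin (2 * n), (i : ℕ) < 2 * k ↔ (D.1 i : ℕ) < 2 * k).card

end LinearizedChordDiagram

/-- The probability that a uniformly random linearized chord diagram with `n` chords and `m`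
crossings has exactly `j` cuts. -/
noncomputable def probCuts (n m j : ℕ) : ℝ :=
  (uniformOn {D : LinearizedChordDiagram n | D.crossings = m}).real {D | D.cuts = j}

/-- `f(x) = ∑_{j ≥ 0} (-1)^j x^{j(j+1)/2}`, where `|x| < 1`. -/
noncomputable def altTheta (x : ℝ) : ℝ :=
  ∑' j : ℕ, (-1 : ℝ) ^ j * x ^ (j + 1).choose 2

/-- `p = 1 - 1 / (2 f(x))`. -/
noncomputable def cutParam (x : ℝ) : ℝ :=
  1 - (2 * altTheta x)⁻¹

/-- `q = m / (m + n)`. -/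
noncomputable def crossingRatio (n m : ℕ) : ℝ :=
  (m : ℝ) / ((m : ℝ) + (n : ℝ))

/-! Let `T(z, x)` count all diagrams, `z` marking chords and `x` crossings, and let `A` count the
nonempty diagrams without cuts. A diagram is a sequence of uncut components, and crossings add over
components, so `T = 1 / (1 - A)`, and the diagrams with `j` cuts are counted by `A ^ (j + 1)`. The
probability is therefore the quotient of the coefficients of `z ^ n x ^ m` in `A ^ (j + 1) = (1 - 1
/ T) ^ (j + 1)` and in `T`.

The Touchard–Riordan formula (`coeff_chordSeries_eq`) writes `(1 - x) ^ n T_n(x)` as an alternating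
theta-like sum of ballot numbers. Dividing by `(1 - x) ^ n` and taking the coefficient of `x ^ m`
amounts to a factor `negBinom n m` times a linear functional sending `x ^ i` to a number that tends
to `q ^ i` (`coeff_eq_ratioFunctional`). Since the ballot numbers satisfy `ballotNum n j / ballotNum
n 0 → 2 j + 1`, the denominator is asymptotic to `negBinom n m * ballotNum n 0 * oddTheta q`, and
`oddTheta q > 0` (`oddTheta_pos`) makes division legitimate.

The numerator follows the principle of a single big component. Scaled Catalan numbers decay
polynomially and are summable, so diagrams with two large components are negligible, and `φ(T)` has
coefficients asymptotic to `φ'(T(z₀))` times those of `T`, where `z₀ = (1 - q) / 4`. Here `φ'(T) =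
(j + 1) (1 - 1 / T) ^ j / T ^ 2`. Every ballot column sums to `2` at `z = 1/4`, whence `T(z₀, q) = 2
f(q)` (`hasSum_scaledEval_chordSeries`), so `1 / T = 1 - p` and the limit is `(j + 1) p ^ j (1 - p)
^ 2`. The expansion of `φ` is made exact by truncating `1 / T` (`exists_uncutSeries_pow_eq`), with
the error controlled by coefficientwise domination (`abs_coeff_le_of_majorized`).

The first two terms of `T(z₀, x)` give `2 f(x) ≥ 1 + (1 - x) / 4`. As `m = O(n)` confines `q_n` to a
compact subset of `[0, 1)`, it suffices to argue along subsequences on which `q_n` converges. -/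

namespace ChordCount

/-! ### Matchings with open chords: inserting one chord. -/

open Finset

/-- Matchings of `Fin N`, as fixed-point-free involutions, in which each of the first `h` points
is joined to a point `≥ h`. -/
def openMatchings (N h : ℕ) : Finset (Fin N → Fin N) :=
  univ.filter fun f => (∀ i, f (f i) = i ∧ f i ≠ i) ∧ ∀ i : Fin N, (i : ℕ) < h → h ≤ (f i : ℕ)

/-- The number of crossings of a matching. -/
def crossingCount {N : ℕ} (f : Fin N → Fin N) : ℕ :=
  ∑ a, ∑ b, if a < b ∧ b < f a ∧ f a < f b then 1 else 0

/-- The number of positions `t ∈ [h, N]` such that no chord joins a point before `t` to a point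
after it. -/
def cutCount {N : ℕ} (h : ℕ) (f : Fin N → Fin N) : ℕ :=
  ((Icc h N).filter fun t : ℕ => ∀ i : Fin N, (i : ℕ) < t ↔ (f i : ℕ) < t).card

lemma mem_openMatchings {N h : ℕ} {f : Fin N → Fin N} : f ∈ openMatchings N h ↔
    (∀ i, f (f i) = i ∧ f i ≠ i) ∧ ∀ i : Fin N, (i : ℕ) < h → h ≤ (f i : ℕ) := by
  simp [openMatchings]

/-- The increasing map from `Fin N` to `Fin (N + 2)` that misses `i` and `h + 1`. -/
def skip (N i h : ℕ) (t : Fin N) : Fin (N + 2) :=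
  ⟨if (t : ℕ) < i then t else if (t : ℕ) < h then t + 1 else t + 2, by split_ifs <;> omega⟩

lemma skip_val {N i h : ℕ} (t : Fin N) : (skip N i h t : ℕ) =
    if (t : ℕ) < i then (t : ℕ) else if (t : ℕ) < h then t + 1 else t + 2 := rfl

section insert

variable {N i h : ℕ}

lemma skip_lt_skip {s t : Fin N} : skip N i h s < skip N i h t ↔ s < t := by
  rw [Fin.lt_def, Fin.lt_def, skip_val, skip_val]
  split_ifs <;> omega

lemma skip_injective : Function.Injective (skip N i h) := by
  intro s t hst
  rcases lt_trichotomy s t with h1 | h1 | h1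
  · exact absurd hst (skip_lt_skip.2 h1).ne
  · exact h1
  · exact absurd hst (skip_lt_skip.2 h1).ne'

lemma eq_or_eq_or_exists_skip (hi : i ≤ h) (hN : h ≤ N) (s : Fin (N + 2)) :
    s = ⟨i, by omega⟩ ∨ s = ⟨h + 1, by omega⟩ ∨ ∃ t, s = skip N i h t := by
  by_cases h1 : (s : ℕ) = i
  · exact Or.inl (Fin.ext h1)
  by_cases h2 : (s : ℕ) = h + 1
  · exact Or.inr (Or.inl (Fin.ext h2))
  right; right
  have := s.2
  by_cases h3 : (s : ℕ) < i
  · exact ⟨⟨s, by omega⟩, Fin.ext (by simp [skip_val, h3])⟩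
  by_cases h4 : (s : ℕ) ≤ h
  · refine ⟨⟨s - 1, by omega⟩, Fin.ext ?_⟩
    rw [skip_val]; simp only; split_ifs <;> omega
  · refine ⟨⟨s - 2, by omega⟩, Fin.ext ?_⟩
    rw [skip_val]; simp only; split_ifs <;> omega

/-- Insert the chord `{i, h + 1}` into a matching. -/
noncomputable def insertChord (i h : ℕ) (f : Fin N → Fin N) (s : Fin (N + 2)) : Fin (N + 2) :=
  Function.extend (skip N i h) (fun t => skip N i h (f t))
    (fun s => if (s : ℕ) = i then Fin.ofNat (N + 2) (h + 1) else Fin.ofNat (N + 2) i) s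

lemma insertChord_skip (f : Fin N → Fin N) (t : Fin N) :
    insertChord i h f (skip N i h t) = skip N i h (f t) :=
  skip_injective.extend_apply _ _ _

lemma skip_ne_left (t : Fin N) : (skip N i h t : ℕ) ≠ i := by
  rw [skip_val]; split_ifs <;> omega

lemma skip_ne_right (t : Fin N) (hi : i ≤ h) : (skip N i h t : ℕ) ≠ h + 1 := by
  rw [skip_val]; split_ifs <;> omega

lemma insertChord_left (hi : i ≤ h) (hN : h ≤ N) (f : Fin N → Fin N) :
    insertChord i h f ⟨i, by omega⟩ = ⟨h + 1, by omega⟩ := by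
  rw [insertChord, Function.extend_apply', if_pos rfl]
  · exact Fin.ext (Nat.mod_eq_of_lt (by omega))
  · rintro ⟨t, ht⟩
    exact skip_ne_left (i := i) (h := h) t (congrArg Fin.val ht)

lemma insertChord_right (hi : i ≤ h) (hN : h ≤ N) (f : Fin N → Fin N) :
    insertChord i h f ⟨h + 1, by omega⟩ = ⟨i, by omega⟩ := by
  rw [insertChord, Function.extend_apply', if_neg]
  · exact Fin.ext (Nat.mod_eq_of_lt (by omega))
  · simp only; omega
  · rintro ⟨t, ht⟩
    exact skip_ne_right t hi (congrArg Fin.val ht)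

lemma insertChord_mem (hi : i ≤ h) (hN : h ≤ N) {f : Fin N → Fin N} (hf : f ∈ openMatchings N h) :
    insertChord i h f ∈ openMatchings (N + 2) (h + 1) := by
  rw [mem_openMatchings] at hf ⊢
  refine ⟨fun s => ?_, fun s hs => ?_⟩
  · rcases eq_or_eq_or_exists_skip hi hN s with rfl | rfl | ⟨t, rfl⟩
    · rw [insertChord_left hi hN, insertChord_right hi hN]
      refine ⟨rfl, fun h1 => ?_⟩
      have := congrArg Fin.val h1; simp only at this; omega
    · rw [insertChord_right hi hN, insertChord_left hi hN]
      refine ⟨rfl, fun h1 => ?_⟩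
      have := congrArg Fin.val h1; simp only at this; omega
    · rw [insertChord_skip, insertChord_skip, (hf.1 t).1]
      exact ⟨rfl, fun h1 => (hf.1 t).2 (skip_injective h1)⟩
  · rcases eq_or_eq_or_exists_skip hi hN s with rfl | rfl | ⟨t, rfl⟩
    · rw [insertChord_left hi hN]
    · simp only at hs; omega
    · rw [insertChord_skip]
      have h1 := hf.2 t
      rw [skip_val] at hs ⊢
      split_ifs at hs ⊢ <;> omega

lemma insertChord_injective : Function.Injective (insertChord (N := N) i h) := by
  intro f g hfg
  ext t
  have := congrFun hfg (skip N i h t)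
  rw [insertChord_skip, insertChord_skip] at this
  rw [skip_injective this]

lemma exists_insertChord (hi : i ≤ h) (hN : h ≤ N) {g : Fin (N + 2) → Fin (N + 2)}
    (hg : g ∈ openMatchings (N + 2) (h + 1)) (hgi : g ⟨h + 1, by omega⟩ = ⟨i, by omega⟩) :
    ∃ f ∈ openMatchings N h, insertChord i h f = g := by
  rw [mem_openMatchings] at hg
  have hgi' : g ⟨i, by omega⟩ = ⟨h + 1, by omega⟩ := by rw [← hgi, (hg.1 _).1]
  have key : ∀ t, ∃ t', g (skip N i h t) = skip N i h t' := by
    intro t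
    rcases eq_or_eq_or_exists_skip hi hN (g (skip N i h t)) with h1 | h1 | h1
    · have h2 := congrArg g h1
      rw [(hg.1 _).1, hgi'] at h2
      exact absurd (congrArg Fin.val h2) (skip_ne_right t hi)
    · have h2 := congrArg g h1
      rw [(hg.1 _).1, hgi] at h2
      exact absurd (congrArg Fin.val h2) (skip_ne_left (i := i) (h := h) t)
    · exact h1
  choose f hf using key
  refine ⟨f, mem_openMatchings.2 ⟨fun t => ⟨?_, fun h1 => ?_⟩, fun t ht => ?_⟩, ?_⟩
  · apply skip_injective (i := i) (h := h)
    rw [← hf, ← hf, (hg.1 _).1]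
  · have := hf t
    rw [h1] at this
    exact (hg.1 _).2 this
  · have h1 := hg.2 (skip N i h t)
    rw [hf, skip_val, skip_val] at h1
    split_ifs at h1 <;> omega
  · funext s
    rcases eq_or_eq_or_exists_skip hi hN s with rfl | rfl | ⟨t, rfl⟩
    · rw [insertChord_left hi hN, hgi']
    · rw [insertChord_right hi hN, hgi]
    · rw [insertChord_skip, hf]

lemma sum_fin_skip {M : Type*} [AddCommMonoid M] (hi : i ≤ h) (hN : h ≤ N)
    (u : Fin (N + 2) → M) :
    ∑ s, u s = u ⟨i, by omega⟩ + (u ⟨h + 1, by omega⟩ + ∑ t, u (skip N i h t)) := by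
  have h1 : (univ : Finset (Fin (N + 2))) =
      insert ⟨i, by omega⟩ (insert ⟨h + 1, by omega⟩ (univ.map ⟨skip N i h, skip_injective⟩)) := by
    ext s
    have := eq_or_eq_or_exists_skip hi hN s
    simp only [mem_univ, mem_insert, Finset.mem_map, true_and, true_iff, Function.Embedding.coeFn_mk]
    rcases this with h | h | ⟨t, h⟩
    · exact Or.inl h
    · exact Or.inr (Or.inl h)
    · exact Or.inr (Or.inr ⟨t, h.symm⟩)
  rw [h1, sum_insert, sum_insert, sum_map]
  · rfl
  · simp only [Finset.mem_map, mem_univ, true_and, Function.Embedding.coeFn_mk, not_exists]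
    exact fun t ht => skip_ne_right t hi (congrArg Fin.val ht)
  · simp only [mem_insert, Finset.mem_map, mem_univ, true_and, Function.Embedding.coeFn_mk, not_or,
      not_exists, Fin.mk.injEq]
    exact ⟨by omega, fun t ht => skip_ne_left (i := i) (h := h) t (congrArg Fin.val ht)⟩

/-- All open chords end to the right of the new chord. Those opened before it pass over it, and
those opened after it, `h - i` in number, cross it. -/
lemma crossingCount_insertChord (hi : i ≤ h) (hN : h ≤ N) {f : Fin N → Fin N}
    (hf : f ∈ openMatchings N h) :
    crossingCount (insertChord i h f) = crossingCount f + (h - i) := by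
  rw [mem_openMatchings] at hf
  have hcard : ∑ t : Fin N, (if i ≤ (t : ℕ) ∧ (t : ℕ) < h then 1 else 0) = h - i := by
    rw [Fin.sum_univ_eq_sum_range (fun t => if i ≤ t ∧ t < h then 1 else 0), ← card_filter]
    have : (range N).filter (fun t => i ≤ t ∧ t < h) = Ico i h := by
      ext t; simp only [mem_filter, Finset.mem_range, Finset.mem_Ico]; omega
    rw [this, Nat.card_Ico]
  unfold crossingCount
  rw [sum_fin_skip hi hN, sum_fin_skip hi hN, sum_fin_skip hi hN, insertChord_left hi hN,
    insertChord_right hi hN, if_neg (by simp), if_neg (by simp), if_neg (by simp),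
    if_neg (by simp)]
  have h1 : ∀ t : Fin N, ((⟨i, by omega⟩ : Fin (N + 2)) < skip N i h t ∧
      skip N i h t < ⟨h + 1, by omega⟩ ∧
      (⟨h + 1, by omega⟩ : Fin (N + 2)) < insertChord i h f (skip N i h t)) ↔
      (i ≤ (t : ℕ) ∧ (t : ℕ) < h) := by
    intro t
    have := hf.2 t
    rw [insertChord_skip, Fin.lt_def, Fin.lt_def, Fin.lt_def, skip_val, skip_val]
    simp only
    split_ifs <;> omega
  have h2 : ∀ t : Fin N, ¬ ((⟨h + 1, by omega⟩ : Fin (N + 2)) < skip N i h t ∧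
      skip N i h t < ⟨i, by omega⟩ ∧
      (⟨i, by omega⟩ : Fin (N + 2)) < insertChord i h f (skip N i h t)) := by
    rintro t ⟨h1, h2, -⟩
    have := Fin.lt_def.1 (h1.trans h2)
    simp only at this
    omega
  simp only [h1, hcard, if_neg (h2 _), sum_const_zero]
  have h3 : ∀ t : Fin N, (∑ b, if skip N i h t < b ∧ b < insertChord i h f (skip N i h t) ∧
      insertChord i h f (skip N i h t) < insertChord i h f b then 1 else 0) =
      ∑ b, if t < b ∧ b < f t ∧ f t < f b then 1 else 0 := by
    intro t
    rw [sum_fin_skip hi hN, insertChord_left hi hN, insertChord_right hi hN, if_neg, if_neg]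
    · simp only [insertChord_skip, skip_lt_skip, zero_add]
    · rintro ⟨h1, h2, h3⟩
      have := Fin.lt_def.1 (h2.trans h3)
      simp only at this
      omega
    · rintro ⟨h1, h2, h3⟩
      have := hf.2 t
      rw [insertChord_skip] at h3
      rw [Fin.lt_def, skip_val] at h1 h3
      simp only at h1 h3
      split_ifs at h1 h3 <;> omega
  simp only [h3]
  omega

lemma cutCount_insertChord (hi : i ≤ h) (hN : h ≤ N) (f : Fin N → Fin N) :
    cutCount (h + 1) (insertChord i h f) = cutCount h f := by
  unfold cutCount
  symm
  -- Position `h + 1` lies between the ends of the new chord, so the counted positions start at `h +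
  -- 2`, matching the old start `h`.
  refine card_bij (fun t _ => t + 2) ?_ (fun _ _ _ _ hab => by omega) ?_
  · intro t ht
    simp only [mem_filter, Finset.mem_Icc] at ht ⊢
    refine ⟨by omega, fun s => ?_⟩
    rcases eq_or_eq_or_exists_skip hi hN s with rfl | rfl | ⟨s, rfl⟩
    · rw [insertChord_left hi hN]; simp only; omega
    · rw [insertChord_right hi hN]; simp only; omega
    · rw [insertChord_skip, skip_val, skip_val]
      have := ht.2 s
      split_ifs <;> omega
  · intro t ht
    simp only [mem_filter, Finset.mem_Icc] at ht
    have h1 := ht.2 ⟨i, by omega⟩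
    rw [insertChord_left hi hN] at h1
    simp only at h1
    refine ⟨t - 2, ?_, by omega⟩
    simp only [mem_filter, Finset.mem_Icc]
    refine ⟨by omega, fun s => ?_⟩
    have h2 := ht.2 (skip N i h s)
    rw [insertChord_skip, skip_val, skip_val] at h2
    split_ifs at h2 <;> omega

end insert

/-! ### Recursion on the number of open chords. -/

section recursion

variable {M : Type*} [AddCommMonoid M]

/-- The sum over `openMatchings N h` of a weight depending on the numbers of crossings and cuts. -/
noncomputable def matchingSum (w : ℕ → ℕ → M) (N h : ℕ) : M :=
  ∑ f ∈ openMatchings N h, w (crossingCount f) (cutCount h f)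

lemma openMatchings_self (h : ℕ) : openMatchings (h + 1) (h + 1) = ∅ := by
  refine eq_empty_of_forall_notMem fun f hf => ?_
  have := (mem_openMatchings.1 hf).2 0 (by simp)
  omega

lemma matchingSum_zero (w : ℕ → ℕ → M) : matchingSum w 0 0 = w 0 1 := by
  have : openMatchings 0 0 = {Fin.elim0} := by
    ext f
    simp [mem_openMatchings, Subsingleton.elim f Fin.elim0]
  rw [matchingSum, this, sum_singleton]
  congr 1

lemma openMatchings_succ {N h : ℕ} (hN : h < N) :
    (openMatchings N h).filter (fun f => h ≤ (f ⟨h, hN⟩ : ℕ)) = openMatchings N (h + 1) := by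
  ext f
  simp only [mem_filter, mem_openMatchings]
  constructor
  · rintro ⟨⟨h1, h2⟩, h3⟩
    refine ⟨h1, fun i hi => ?_⟩
    rcases Nat.lt_succ_iff_lt_or_eq.1 hi with h4 | h4
    · have h5 := h2 i h4
      rcases h5.lt_or_eq with h6 | h6
      · omega
      · have h7 : f i = ⟨h, hN⟩ := Fin.ext h6.symm
        rw [← h7, (h1 i).1] at h3
        omega
    · have h5 : i = ⟨h, hN⟩ := Fin.ext h4
      have h6 := (h1 i).2
      rw [← h5] at h3
      have : (f i : ℕ) ≠ i := fun h => h6 (Fin.ext h)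
      omega
  · rintro ⟨h1, h2⟩
    refine ⟨⟨h1, fun i hi => ?_⟩, ?_⟩
    · have := h2 i (by omega); omega
    · have := h2 ⟨h, hN⟩ (by simp); omega

/-- For `h > 0` the chord at the point `0` passes over position `h`, so this position counts only
when `h = 0`. -/
lemma cutCount_succ {N h : ℕ} (hN : h < N) {f : Fin N → Fin N} (hf : f ∈ openMatchings N (h + 1)) :
    cutCount h f = cutCount (h + 1) f + if h = 0 then 1 else 0 := by
  rw [mem_openMatchings] at hf
  unfold cutCount
  rw [← Finset.insert_Icc_succ_left_eq_Icc hN.le, filter_insert]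
  split_ifs with h1 h2 h2
  · rw [card_insert_of_notMem (by simp)]; rfl
  · have h3 := h1 ⟨0, by omega⟩
    have h4 := hf.2 ⟨0, by omega⟩ (by simp)
    simp only at h3
    omega
  · exact absurd (fun i => by simp [h2]) h1
  · rfl

lemma matchingSum_zero_right (w : ℕ → ℕ → M) {N : ℕ} (hN : 0 < N) :
    matchingSum w N 0 = matchingSum (fun c t => w c (t + 1)) N 1 := by
  unfold matchingSum
  have h0 : openMatchings N 0 = openMatchings N 1 := by
    rw [← openMatchings_succ hN, filter_true_of_mem (fun _ _ => Nat.zero_le _)]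
  rw [h0]
  refine sum_congr rfl fun f hf => ?_
  rw [cutCount_succ hN hf, if_pos rfl]

/-- The point `h + 1` either opens a chord or closes one of the `h + 1` open ones. In the second
case deleting the chord from `h + 1` to `i` removes `h - i` crossings; reversing the index turns `h
- i` into `i`. -/
lemma matchingSum_succ_right (w : ℕ → ℕ → M) {N h : ℕ} (hN : h ≤ N) :
    matchingSum w (N + 2) (h + 1) = matchingSum w (N + 2) (h + 2) +
      ∑ i ∈ range (h + 1), matchingSum (fun c t => w (c + i) t) N h := by
  have hN' : h + 1 < N + 2 := by omega
  unfold matchingSum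
  rw [← sum_filter_add_sum_filter_not _ (fun f => h + 1 ≤ (f ⟨h + 1, hN'⟩ : ℕ)),
    openMatchings_succ hN', ← sum_range_reflect]
  congr 1
  · refine sum_congr rfl fun f hf => ?_
    rw [cutCount_succ hN' hf, if_neg (by omega), add_zero]
  · rw [← sum_fiberwise_of_maps_to (t := range (h + 1)) (g := fun f => (f ⟨h + 1, hN'⟩ : ℕ))]
    · refine sum_congr rfl fun i hi => ?_
      rw [Finset.mem_range] at hi
      symm
      refine sum_bij (fun f _ => insertChord i h f) ?_ (fun _ _ _ _ hab => insertChord_injective hab)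
        ?_ ?_
      · intro f hf
        simp only [mem_filter]
        rw [insertChord_right (by omega) hN]
        exact ⟨⟨insertChord_mem (by omega) hN hf, by simp only; omega⟩, rfl⟩
      · intro g hg
        simp only [mem_filter] at hg
        obtain ⟨f, hf, hfg⟩ := exists_insertChord (i := i) (by omega) hN hg.1.1 (Fin.ext hg.2)
        exact ⟨f, hf, hfg⟩
      · intro f hf
        rw [crossingCount_insertChord (by omega) hN hf, cutCount_insertChord (by omega) hN f]
        congr 2
    · intro f hf
      simp only [mem_filter, Finset.mem_range] at hf ⊢
      omega

end recursion

end ChordCount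

namespace ChordCount

open Finset

/-! ### Decomposition into components and generating series. -/

section firstPassage

variable {K : Type*} [CommRing K] (x : K)

/-- The generating polynomial, by crossings, of the ways to close `h` open chords for the first
time after `k` more points. -/
def firstPassage : ℕ → ℕ → K
  | 0, 0 => 1
  | 0, _ + 1 => 0
  | _ + 1, 0 => 0
  | k + 1, h + 1 => firstPassage k (h + 2) + (∑ i ∈ range (h + 1), x ^ i) * firstPassage k h

lemma firstPassage_of_odd (k : ℕ) : ∀ h, Odd (k + h) → firstPassage x k h = 0 := by
  induction k with
  | zero =>
    rintro (_ | h) hh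
    · simp at hh
    · rw [firstPassage]
  | succ k ih =>
    rintro (_ | h) hh
    · rw [firstPassage]
    · rw [firstPassage, ih, ih]
      · simp
      · obtain ⟨a, ha⟩ := hh; exact ⟨a - 1, by omega⟩
      · obtain ⟨a, ha⟩ := hh; exact ⟨a, by omega⟩

/-- The generating function of open matchings by crossings, with weight `ν t` for `t` cuts. -/
noncomputable def openSum (ν : ℕ → K) (N h : ℕ) : K :=
  matchingSum (fun c t => x ^ c * ν t) N h

lemma openSum_zero (ν : ℕ → K) : openSum x ν 0 0 = ν 1 := by
  simp [openSum, matchingSum_zero]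

lemma openSum_self (ν : ℕ → K) (h : ℕ) : openSum x ν (h + 1) (h + 1) = 0 := by
  simp [openSum, matchingSum, openMatchings_self]

lemma openSum_zero_right (ν : ℕ → K) {N : ℕ} (hN : 0 < N) :
    openSum x ν N 0 = openSum x (fun t => ν (t + 1)) N 1 :=
  matchingSum_zero_right _ hN

lemma openSum_succ_right (ν : ℕ → K) (L h : ℕ) :
    openSum x ν (h + 1 + (L + 1)) (h + 1) =
      openSum x ν (h + 2 + L) (h + 2) + (∑ i ∈ range (h + 1), x ^ i) * openSum x ν (h + L) h := by
  have h1 : h + 1 + (L + 1) = h + L + 2 := by omega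
  have h2 : h + 2 + L = h + L + 2 := by omega
  unfold openSum
  rw [h1, h2, matchingSum_succ_right _ (Nat.le_add_right h L), sum_mul]
  congr 1
  refine sum_congr rfl fun i _ => ?_
  unfold matchingSum
  rw [mul_sum]
  exact sum_congr rfl fun f _ => by ring

/-- A matching is split at the first moment at which no chord is open; what remains is an arbitrary
matching. -/
lemma openSum_eq_sum_firstPassage (ν : ℕ → K) (L : ℕ) : ∀ h, openSum x ν (h + L) h =
    ∑ p ∈ antidiagonal L, firstPassage x p.1 h * openSum x ν p.2 0 := by
  induction L with
  | zero =>
    rintro (_ | h)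
    · simp [firstPassage]
    · simp [firstPassage, openSum_self]
  | succ L ih =>
    rintro (_ | h)
    · rw [Finset.Nat.sum_antidiagonal_succ]
      simp [firstPassage]
    · rw [Finset.Nat.sum_antidiagonal_succ, openSum_succ_right, ih, ih, mul_sum, ← sum_add_distrib]
      simp only [firstPassage, zero_mul, zero_add]
      exact sum_congr rfl fun p _ => by ring

lemma sum_range_two_mul {M : Type*} [AddCommMonoid M] (u : ℕ → M) (n : ℕ) :
    ∑ i ∈ range (2 * n), u i = ∑ i ∈ range n, (u (2 * i) + u (2 * i + 1)) := by
  induction n with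
  | zero => simp
  | succ n ih => rw [mul_add, sum_range_succ, sum_range_succ, ih, sum_range_succ, add_assoc]

lemma openSum_two_mul_succ (ν : ℕ → K) (n : ℕ) : openSum x ν (2 * (n + 1)) 0 =
    ∑ p ∈ antidiagonal n,
      firstPassage x (2 * p.1 + 1) 1 * openSum x (fun t => ν (t + 1)) (2 * p.2) 0 := by
  have h1 : 2 * (n + 1) = 1 + (2 * n + 1) := by omega
  rw [openSum_zero_right x ν (by omega), h1, openSum_eq_sum_firstPassage,
    Finset.Nat.sum_antidiagonal_eq_sum_range_succ_mk,
    Finset.Nat.sum_antidiagonal_eq_sum_range_succ_mk]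
  have h2 : (2 * n + 1).succ = 2 * (n + 1) := by omega
  rw [h2, sum_range_two_mul]
  refine sum_congr rfl fun i hi => ?_
  rw [firstPassage_of_odd x (2 * i) 1 ⟨i, rfl⟩, zero_mul, zero_add]
  have h3 : 2 * n + 1 - (2 * i + 1) = 2 * (n - i) := by omega
  simp only [h3]

end firstPassage

open Polynomial

/-- The generating series of matchings, with `z` marking chords, `X` marking crossings, and weight
`ν (t + 2)` for `t` cuts. -/
noncomputable def matchingSeries (ν : ℕ → ℝ[X]) : PowerSeries ℝ[X] :=
  PowerSeries.mk fun n => openSum X ν (2 * n) 0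

/-- The generating series of nonempty matchings without cuts. -/
noncomputable def uncutSeries : PowerSeries ℝ[X] :=
  PowerSeries.mk fun n => match n with
    | 0 => 0
    | n + 1 => firstPassage X (2 * n + 1) 1

/-- The generating series of all matchings. -/
noncomputable def chordSeries : PowerSeries ℝ[X] := matchingSeries fun _ => 1

/-- Splitting off the first component removes one cut position, which shifts `ν`. The empty matching
has a single position, giving the constant `ν 1`. -/
lemma matchingSeries_eq (ν : ℕ → ℝ[X]) : matchingSeries ν =
    PowerSeries.C (ν 1) + uncutSeries * matchingSeries fun t => ν (t + 1) := by
  ext1 n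
  rcases n with _ | n
  · simp [matchingSeries, uncutSeries, openSum_zero]
  · rw [map_add, PowerSeries.coeff_mul, Finset.Nat.sum_antidiagonal_succ]
    simp only [matchingSeries, uncutSeries, PowerSeries.coeff_mk, PowerSeries.coeff_C]
    rw [openSum_two_mul_succ]
    simp

lemma chordSeries_eq : chordSeries = 1 + uncutSeries * chordSeries := by
  unfold chordSeries
  nth_rewrite 1 [matchingSeries_eq]
  simp

lemma matchingSeries_zero : matchingSeries 0 = 0 := by
  ext1 n
  simp [matchingSeries, openSum, matchingSum]

/-- With both ends of the line counted, `j` components have `j + 1` boundary positions. -/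
lemma matchingSeries_single (j : ℕ) :
    matchingSeries (fun t => if t = j + 1 then 1 else 0) = uncutSeries ^ j := by
  induction j with
  | zero =>
    rw [matchingSeries_eq, matchingSeries_eq]
    have : (fun t : ℕ => if t + 1 + 1 = 0 + 1 then (1 : ℝ[X]) else 0) = 0 := by
      ext1 t; simp
    simp only [this, matchingSeries_zero]
    simp
  | succ j ih =>
    rw [matchingSeries_eq, pow_succ', ← ih]
    simp

/-- The involution acts on the first `t` points without fixed points, so they cancel in pairs modulo
`2`. Hence restricting cuts to positions `2 k` loses nothing. -/
lemma even_of_forall_lt_iff {N t : ℕ} {f : Fin N → Fin N} (hf : ∀ i, f (f i) = i ∧ f i ≠ i)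
    (ht : t ≤ N) (h : ∀ i : Fin N, (i : ℕ) < t ↔ (f i : ℕ) < t) : Even t := by
  have h1 : ∑ i ∈ univ.filter (fun i : Fin N => (i : ℕ) < t), (1 : ZMod 2) = 0 := by
    refine sum_involution (fun i _ => f i) (fun _ _ => by decide) (fun i _ _ => (hf i).2)
      (fun i hi => ?_) (fun i _ => (hf i).1)
    simp only [mem_filter, Finset.mem_univ, true_and] at hi ⊢
    exact (h i).1 hi
  rw [sum_const, nsmul_one, ZMod.natCast_eq_zero_iff_even] at h1
  have h2 : (univ.filter (fun i : Fin N => (i : ℕ) < t)).card = t := by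
    rw [Fin.card_filter_val_lt, min_eq_right ht]
  rwa [h2] at h1

lemma cutCount_eq_cuts {n : ℕ} (hn : 0 < n) (D : LinearizedChordDiagram n) :
    cutCount 0 (D.1 : Fin (2 * n) → Fin (2 * n)) = D.cuts + 2 := by
  have h1 : ((Icc 0 (2 * n)).filter fun t : ℕ =>
      ∀ i : Fin (2 * n), (i : ℕ) < t ↔ (D.1 i : ℕ) < t) =
      insert 0 (insert (2 * n) (((Finset.Ioo 0 n).filter fun k : ℕ =>
        ∀ i : Fin (2 * n), (i : ℕ) < 2 * k ↔ (D.1 i : ℕ) < 2 * k).image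
          fun k => 2 * k)) := by
    ext t
    simp only [mem_filter, Finset.mem_Icc, Finset.mem_insert, Finset.mem_image, Finset.mem_Ioo]
    constructor
    · rintro ⟨h1, h2⟩
      obtain ⟨k, hk⟩ := even_of_forall_lt_iff D.2 h1.2 h2
      obtain rfl : t = 2 * k := by omega
      by_cases h3 : k = 0
      · left; omega
      by_cases h4 : k = n
      · right; left; omega
      · right; right
        exact ⟨k, ⟨by omega, h2⟩, rfl⟩
    · rintro (rfl | rfl | ⟨k, h1, rfl⟩)
      · simp
      · simp
      · exact ⟨by omega, h1.2⟩
  unfold cutCount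
  rw [h1, card_insert_of_notMem, card_insert_of_notMem, card_image_of_injective]
  · rfl
  · exact fun _ _ hab => by simpa using hab
  · simp only [Finset.mem_image, mem_filter, Finset.mem_Ioo, not_exists, not_and]
    intro k hk _
    omega
  · simp only [Finset.mem_insert, Finset.mem_image, mem_filter, Finset.mem_Ioo, not_or, not_exists,
      not_and]
    exact ⟨by omega, fun k hk _ => by omega⟩

lemma crossingCount_eq_crossings {n : ℕ} (D : LinearizedChordDiagram n) :
    crossingCount (D.1 : Fin (2 * n) → Fin (2 * n)) = D.crossings := by
  unfold crossingCount LinearizedChordDiagram.crossings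
  rw [card_filter, Fintype.sum_prod_type]

lemma sum_diagrams {M : Type*} [AddCommMonoid M] (w : ℕ → ℕ → M) {n : ℕ} (hn : 0 < n) :
    ∑ D : LinearizedChordDiagram n, w D.crossings (D.cuts + 2) = matchingSum w (2 * n) 0 := by
  unfold matchingSum
  refine sum_bij (fun D _ => (D.1 : Fin (2 * n) → Fin (2 * n))) ?_ ?_ ?_ ?_
  · intro D _
    exact mem_openMatchings.2 ⟨D.2, by simp⟩
  · intro D _ D' _ h
    exact Subtype.ext (DFunLike.coe_injective h)
  · intro f hf
    have hf := (mem_openMatchings.1 hf).1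
    have hi : Function.Involutive f := fun i => (hf i).1
    exact ⟨⟨hi.toPerm, hf⟩, mem_univ _, rfl⟩
  · intro D _
    rw [crossingCount_eq_crossings, cutCount_eq_cuts hn]

lemma card_crossings_eq (n m : ℕ) (hn : 0 < n) :
    ((univ.filter fun D : LinearizedChordDiagram n => D.crossings = m).card : ℝ) =
      (PowerSeries.coeff n chordSeries).coeff m := by
  rw [chordSeries, matchingSeries, PowerSeries.coeff_mk, openSum, ← sum_diagrams _ hn,
    finsetSum_coeff, card_filter, Nat.cast_sum]
  refine sum_congr rfl fun D _ => ?_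
  simp [coeff_X_pow, eq_comm]

lemma card_crossings_cuts_eq (n m j : ℕ) (hn : 0 < n) :
    ((univ.filter fun D : LinearizedChordDiagram n => D.crossings = m ∧ D.cuts = j).card : ℝ) =
      (PowerSeries.coeff n (uncutSeries ^ (j + 1))).coeff m := by
  rw [← matchingSeries_single, matchingSeries, PowerSeries.coeff_mk, openSum, ← sum_diagrams _ hn,
    finsetSum_coeff, card_filter, Nat.cast_sum]
  refine sum_congr rfl fun D _ => ?_
  by_cases h : D.cuts = j
  · simp [coeff_X_pow, eq_comm, h]
  · simp [h]

lemma probCuts_eq (n m j : ℕ) (hn : 0 < n) : probCuts n m j =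
    (PowerSeries.coeff n (uncutSeries ^ (j + 1))).coeff m /
      (PowerSeries.coeff n chordSeries).coeff m := by
  classical
  rw [← card_crossings_eq n m hn, ← card_crossings_cuts_eq n m j hn, probCuts]
  have h1 : {D : LinearizedChordDiagram n | D.crossings = m} =
      ((univ.filter fun D : LinearizedChordDiagram n => D.crossings = m : Finset _) : Set _) := by
    ext D; simp
  have h2 : {D : LinearizedChordDiagram n | D.cuts = j} =
      ((univ.filter fun D : LinearizedChordDiagram n => D.cuts = j : Finset _) : Set _) := by
    ext D; simp
  rw [h1, h2, measureReal_def, uniformOn_apply_finset, ← filter_and]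
  simp

end ChordCount

namespace ChordCount

open Finset

/-! ### The Touchard–Riordan formula. -/

section TouchardRiordan

variable {K : Type*} [CommRing K] (x : K)

/-- The coefficients `(-1)^j x^(j+1 choose 2) ∏_{i=1}^h (1 - x^(j+i))` of the expansion of
generating functions of matchings in ballot numbers. -/
def thetaCoeff (h j : ℕ) : K :=
  (-1) ^ j * x ^ (j + 1).choose 2 * ∏ i ∈ range h, (1 - x ^ (j + i + 1))

lemma choose_two_succ (j : ℕ) : (j + 2).choose 2 = (j + 1).choose 2 + (j + 1) := by
  rw [Nat.choose_succ_succ' (j + 1) 1, Nat.choose_one_right, add_comm]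

lemma thetaCoeff_zero_right (h : ℕ) :
    thetaCoeff x (h + 1) 0 = (1 - x ^ (h + 1)) * thetaCoeff x h 0 := by
  simp [thetaCoeff, prod_range_succ, mul_comm]

lemma thetaCoeff_zero_left (j : ℕ) :
    thetaCoeff x 0 (j + 1) + thetaCoeff x 0 j = thetaCoeff x 1 j := by
  simp only [thetaCoeff, range_zero, prod_empty, range_one, prod_singleton, choose_two_succ]
  ring

/-- This compares the coefficients of one ballot number on the two sides of the recursion for
`openSum`, after `1 - x` has turned the geometric sum into `1 - x ^ (h + 1)`. -/
lemma thetaCoeff_succ_succ (h j : ℕ) : thetaCoeff x (h + 1) (j + 1) + thetaCoeff x (h + 1) j =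
    (1 - x ^ (h + 1)) * thetaCoeff x h (j + 1) + thetaCoeff x (h + 2) j := by
  have h1 : ∏ i ∈ range (h + 1), (1 - x ^ (j + i + 1)) =
      (1 - x ^ (j + 1)) * ∏ i ∈ range h, (1 - x ^ (j + 1 + i + 1)) := by
    rw [prod_range_succ', mul_comm]
    congr 1
    exact prod_congr rfl fun i _ => by congr 2; omega
  have h2 : ∏ i ∈ range (h + 2), (1 - x ^ (j + i + 1)) = (1 - x ^ (j + 1)) *
      (∏ i ∈ range h, (1 - x ^ (j + 1 + i + 1))) * (1 - x ^ (j + h + 2)) := by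
    rw [prod_range_succ, h1]
    rfl
  simp only [thetaCoeff, choose_two_succ]
  rw [h1, h2, prod_range_succ]
  ring

lemma sum_thetaCoeff_succ (d : ℕ → K) (h J : ℕ) :
    ∑ j ∈ range (J + 1), thetaCoeff x (h + 1) j * (d j + d (j + 1)) =
      (1 - x ^ (h + 1)) * ∑ j ∈ range (J + 1), thetaCoeff x h j * d j +
        ∑ j ∈ range J, thetaCoeff x (h + 2) j * d (j + 1) + thetaCoeff x (h + 1) J * d (J + 1) := by
  induction J with
  | zero => simp [thetaCoeff_zero_right]; ring
  | succ J ih =>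
    rw [sum_range_succ, ih, sum_range_succ _ (J + 1),
      sum_range_succ (fun j => thetaCoeff x (h + 2) j * d (j + 1)) J]
    linear_combination d (J + 1) * thetaCoeff_succ_succ x h J

lemma sum_thetaCoeff_zero (d : ℕ → K) (J : ℕ) :
    ∑ j ∈ range (J + 1), thetaCoeff x 0 j * (d j + d (j + 1)) =
      d 0 + ∑ j ∈ range J, thetaCoeff x 1 j * d (j + 1) + thetaCoeff x 0 J * d (J + 1) := by
  induction J with
  | zero => simp [thetaCoeff]
  | succ J ih =>
    rw [sum_range_succ, ih, sum_range_succ (fun j => thetaCoeff x 1 j * d (j + 1)) J]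
    linear_combination d (J + 1) * thetaCoeff_zero_left x J

/-- The number of nonnegative lattice paths of length `L` from height `0` to height `h`. -/
def ballot : ℕ → ℕ → ℕ
  | 0, 0 => 1
  | 0, _ + 1 => 0
  | L + 1, 0 => ballot L 1
  | L + 1, h + 1 => ballot L h + ballot L (h + 2)

lemma ballot_eq_zero (L : ℕ) : ∀ h, L < h → ballot L h = 0 := by
  induction L with
  | zero =>
    rintro (_ | h) hh
    · omega
    · rw [ballot]
  | succ L ih =>
    rintro (_ | h) hh
    · omega
    · rw [ballot, ih _ (by omega), ih _ (by omega)]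

/-- Both sides satisfy the same recursion in `L`: the ballot numbers absorb the unweighted path
steps and `thetaCoeff` the weights of closing steps. The condition on `J` makes all omitted ballot
numbers vanish. -/
lemma openSum_eq_sum_thetaCoeff (L : ℕ) : ∀ h n J, h + L = 2 * n → L < h + 2 * J →
    (1 - x) ^ n * openSum x (fun _ => 1) (h + L) h =
      ∑ j ∈ range J, thetaCoeff x h j * (ballot L (h + 2 * j) : K) := by
  induction L with
  | zero =>
    rintro (_ | h) n J hn hJ
    · obtain rfl : n = 0 := by omega
      obtain ⟨J, rfl⟩ : ∃ J', J = J' + 1 := ⟨J - 1, by omega⟩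
      rw [sum_range_succ', sum_eq_zero]
      · simp [thetaCoeff, openSum_zero, ballot]
      · intro j _
        rw [ballot_eq_zero _ _ (by omega)]
        simp
    · rw [add_zero, openSum_self, sum_eq_zero]
      · simp
      · intro j _
        rw [ballot_eq_zero _ _ (by omega)]
        simp
  | succ L ih =>
    rintro (_ | h) n J hn hJ
    · obtain ⟨J, rfl⟩ : ∃ J', J = J' + 1 := ⟨J - 1, by omega⟩
      -- The value `0` at index `0` plays the role of a ballot number at height `-1`.
      have h1 := sum_thetaCoeff_zero x
        (fun j => match j with
          | 0 => 0
          | j + 1 => (ballot L (1 + 2 * j) : K)) J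
      have h2 : ∀ j, (ballot (L + 1) (0 + 2 * j) : K) = (match j with
          | 0 => 0
          | j + 1 => (ballot L (1 + 2 * j) : K)) + (ballot L (1 + 2 * j) : K) := by
        rintro (_ | j)
        · simp [ballot]
        · have h3 : 0 + 2 * (j + 1) = (1 + 2 * j) + 1 := by omega
          rw [h3, ballot]
          push_cast
          rfl
      simp only [h2]
      rw [h1, zero_add, openSum_zero_right x _ (by omega), add_comm L 1,
        ih 1 n J (by omega) (by omega)]
      dsimp only
      rw [ballot_eq_zero L (1 + 2 * J) (by omega)]
      simp
    · obtain ⟨n, rfl⟩ : ∃ n', n = n' + 1 := ⟨n - 1, by omega⟩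
      have h1 : (1 - x) ^ (n + 1) * openSum x (fun _ => 1) (h + 1 + (L + 1)) (h + 1) =
          (1 - x) ^ (n + 1) * openSum x (fun _ => 1) (h + 2 + L) (h + 2) +
            (1 - x ^ (h + 1)) * ((1 - x) ^ n * openSum x (fun _ => 1) (h + L) h) := by
        rw [openSum_succ_right, ← mul_neg_geom_sum x (h + 1)]
        ring
      rw [h1, ih h n J (by omega) (by omega)]
      rcases J with _ | J
      · rw [ih (h + 2) (n + 1) 0 (by omega) (by omega)]
        simp
      · rw [ih (h + 2) (n + 1) J (by omega) (by omega)]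
        have h2 : ∀ j, (ballot (L + 1) (h + 1 + 2 * j) : K) =
            (ballot L (h + 2 * j) : K) + (ballot L (h + 2 * (j + 1)) : K) := by
          intro j
          have h3 : h + 1 + 2 * j = (h + 2 * j) + 1 := by omega
          rw [h3, ballot]
          push_cast
          rfl
        simp only [h2]
        rw [sum_thetaCoeff_succ, ballot_eq_zero L (h + 2 * (J + 1)) (by omega)]
        have h3 : ∀ j, h + 2 + 2 * j = h + 2 * (j + 1) := fun j => by omega
        simp only [h3]
        simp
        ring

end TouchardRiordan

lemma ballot_eq_choose (L : ℕ) : ∀ h n, L + h = 2 * n →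
    (ballot L h : ℤ) = L.choose n - L.choose (n + 1) := by
  induction L with
  | zero =>
    rintro (_ | h) n hn
    · obtain rfl : n = 0 := by omega
      simp [ballot]
    · obtain ⟨n, rfl⟩ : ∃ n', n = n' + 1 := ⟨n - 1, by omega⟩
      simp [ballot]
  | succ L ih =>
    rintro (_ | h) n hn
    · obtain ⟨n, rfl⟩ : ∃ n', n = n' + 1 := ⟨n - 1, by omega⟩
      rw [ballot, ih 1 (n + 1) (by omega), Nat.choose_succ_succ', Nat.choose_succ_succ',
        Nat.choose_symm_of_eq_add (show L = n + (n + 1) by omega)]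
      push_cast
      ring
    · obtain ⟨n, rfl⟩ : ∃ n', n = n' + 1 := ⟨n - 1, by omega⟩
      rw [ballot, Nat.cast_add, ih h n (by omega), ih (h + 2) (n + 1) (by omega),
        Nat.choose_succ_succ', Nat.choose_succ_succ']
      push_cast
      ring

/-- The ballot number `(2n choose n+j) - (2n choose n+j+1)`, as a real number. -/
noncomputable def ballotNum (n j : ℕ) : ℝ := ballot (2 * n) (2 * j)

lemma ballotNum_nonneg (n j : ℕ) : 0 ≤ ballotNum n j := Nat.cast_nonneg _

lemma ballotNum_eq_zero {n j : ℕ} (h : n < j) : ballotNum n j = 0 := by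
  rw [ballotNum, ballot_eq_zero _ _ (by omega), Nat.cast_zero]

lemma ballotNum_succ_zero (n : ℕ) : ballotNum (n + 1) 0 = ballotNum n 0 + ballotNum n 1 := by
  simp only [ballotNum]
  rw [mul_add, mul_zero, ballot, ballot]
  push_cast
  rfl

lemma ballotNum_succ_succ (n j : ℕ) : ballotNum (n + 1) (j + 1) =
    ballotNum n j + 2 * ballotNum n (j + 1) + ballotNum n (j + 2) := by
  simp only [ballotNum]
  have h1 : 2 * (j + 1) = 2 * j + 1 + 1 := by omega
  have h2 : 2 * (j + 2) = 2 * j + 1 + 1 + 2 := by omega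
  rw [mul_add 2 n, h1, h2, ballot, ballot, ballot]
  push_cast
  ring

lemma ballotNum_eq (n j : ℕ) :
    ballotNum n j = (2 * j + 1) / (n + j + 1) * (2 * n).choose (n + j) := by
  have h1 : ballotNum n j = (2 * n).choose (n + j) - (2 * n).choose (n + j + 1) := by
    have := ballot_eq_choose (2 * n) (2 * j) (n + j) (by omega)
    rw [ballotNum]
    exact_mod_cast this
  have h2 : (n + j + 1 : ℝ) * (2 * n).choose (n + j + 1) =
      (n - j) * (2 * n).choose (n + j) := by
    rcases le_or_gt j n with h | h
    · have h3 := Nat.choose_succ_right_eq (2 * n) (n + j)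
      have h4 : 2 * n - (n + j) = n - j := by omega
      rw [h4] at h3
      have h5 : ((2 * n).choose (n + j + 1) : ℝ) * (n + j + 1) =
          (2 * n).choose (n + j) * (n - j) := by
        have := congrArg (Nat.cast (R := ℝ)) h3
        push_cast [Nat.cast_sub h] at this
        exact this
      linarith
    · rw [Nat.choose_eq_zero_of_lt (show 2 * n < n + j by omega),
        Nat.choose_eq_zero_of_lt (show 2 * n < n + j + 1 by omega)]
      simp
  rw [h1]
  field_simp
  linarith

/-- **Touchard–Riordan formula**. -/
lemma coeff_chordSeries_eq {n J : ℕ} (hJ : n < J) :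
    (1 - Polynomial.X) ^ n * PowerSeries.coeff n chordSeries =
      ∑ j ∈ range J, thetaCoeff Polynomial.X 0 j * Polynomial.C (ballotNum n j) := by
  have := openSum_eq_sum_thetaCoeff (Polynomial.X : Polynomial ℝ) (2 * n) 0 n J (by omega)
    (by omega)
  simp only [zero_add] at this
  rw [chordSeries, matchingSeries, PowerSeries.coeff_mk, this]
  simp [ballotNum]

end ChordCount

namespace ChordCount

/-! ### Asymptotics and sums of ballot and Catalan numbers. -/

open Finset

lemma ballotNum_zero_right (n : ℕ) : ballotNum n 0 = n.centralBinom / (n + 1) := by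
  rw [ballotNum_eq, Nat.centralBinom_eq_two_mul_choose]
  simp
  ring

lemma ballotNum_zero_right_eq_catalan (n : ℕ) : ballotNum n 0 = catalan n := by
  rw [ballotNum_zero_right, ← succ_mul_catalan_eq_centralBinom]
  push_cast
  field_simp

/-- The Catalan numbers scaled by `4^n`. -/
noncomputable def scaledCatalan (n : ℕ) : ℝ := ballotNum n 0 / 4 ^ n

lemma ballotNum_zero_right_pos (n : ℕ) : 0 < ballotNum n 0 := by
  rw [ballotNum_zero_right]
  have := n.centralBinom_pos
  positivity

lemma scaledCatalan_pos (n : ℕ) : 0 < scaledCatalan n :=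
  div_pos (ballotNum_zero_right_pos n) (by positivity)

lemma scaledCatalan_succ (n : ℕ) :
    scaledCatalan (n + 1) = (2 * n + 1) / (2 * n + 4) * scaledCatalan n := by
  have h1 := congrArg (Nat.cast (R := ℝ)) n.succ_mul_centralBinom_succ
  push_cast at h1
  have h2 : ((n + 1).centralBinom : ℝ) = 2 * (2 * n + 1) * n.centralBinom / (n + 1) := by
    rw [← h1]
    field_simp
  rw [scaledCatalan, scaledCatalan, ballotNum_zero_right, ballotNum_zero_right, h2]
  push_cast
  field_simp
  ring

lemma scaledCatalan_succ_le (n : ℕ) : scaledCatalan (n + 1) ≤ scaledCatalan n := by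
  rw [scaledCatalan_succ]
  refine mul_le_of_le_one_left (scaledCatalan_pos n).le ?_
  rw [div_le_one (by positivity)]
  linarith

/-- This is a crude form of polynomial decay: halving the index costs at most a factor `4`. -/
lemma sq_mul_scaledCatalan_monotone :
    Monotone fun n : ℕ => (n + 1 : ℝ) ^ 2 * scaledCatalan n := by
  refine monotone_nat_of_le_succ fun n => ?_
  rw [scaledCatalan_succ, ← mul_assoc]
  refine mul_le_mul_of_nonneg_right ?_ (scaledCatalan_pos n).le
  rw [mul_div_assoc', le_div_iff₀ (by positivity)]
  push_cast
  nlinarith [(Nat.cast_nonneg n : (0 : ℝ) ≤ n)]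

lemma scaledCatalan_le_four_mul {k n : ℕ} (h1 : k ≤ n) (h2 : n ≤ 2 * k + 1) :
    scaledCatalan k ≤ 4 * scaledCatalan n := by
  have h3 : (k + 1 : ℝ) ^ 2 * scaledCatalan k ≤ (n + 1 : ℝ) ^ 2 * scaledCatalan n :=
    sq_mul_scaledCatalan_monotone h1
  have h4 : (n + 1 : ℝ) ^ 2 ≤ 4 * (k + 1) ^ 2 := by
    have : (n : ℝ) ≤ 2 * k + 1 := by exact_mod_cast h2
    nlinarith [(Nat.cast_nonneg n : (0 : ℝ) ≤ n)]
  have h5 : (k + 1 : ℝ) ^ 2 * scaledCatalan k ≤ (k + 1 : ℝ) ^ 2 * (4 * scaledCatalan n) := by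
    calc _ ≤ _ := h3
      _ ≤ 4 * (k + 1) ^ 2 * scaledCatalan n :=
        mul_le_mul_of_nonneg_right h4 (scaledCatalan_pos n).le
      _ = _ := by ring
  exact le_of_mul_le_mul_left h5 (by positivity)

lemma sum_scaledCatalan_mul (n : ℕ) :
    ∑ p ∈ antidiagonal n, scaledCatalan p.1 * scaledCatalan p.2 ≤ 4 * scaledCatalan n := by
  have h1 : ∑ p ∈ antidiagonal n, scaledCatalan p.1 * scaledCatalan p.2 =
      4 * scaledCatalan (n + 1) := by
    have h2 : ballotNum (n + 1) 0 =
        ∑ p ∈ antidiagonal n, ballotNum p.1 0 * ballotNum p.2 0 := by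
      simp only [ballotNum_zero_right_eq_catalan, catalan_succ']
      push_cast
      rfl
    rw [scaledCatalan, h2, sum_div, mul_sum]
    refine sum_congr rfl fun p hp => ?_
    rw [← mem_antidiagonal.1 hp, scaledCatalan, scaledCatalan]
    field_simp
    ring
  rw [h1]
  linarith [scaledCatalan_succ_le n]

/-- Induction shows that the square times `2 n + 1` never exceeds `1`, so Stirling's formula is not
needed. -/
lemma tendsto_centralBinom_div :
    Tendsto (fun n : ℕ => (n.centralBinom : ℝ) / 4 ^ n) atTop (𝓝 0) := by
  have h1 : ∀ n : ℕ, ((n.centralBinom : ℝ) / 4 ^ n) ^ 2 ≤ 1 / ((n : ℝ) + 1) := by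
    intro n
    suffices h : ((n.centralBinom : ℝ) / 4 ^ n) ^ 2 * (2 * n + 1) ≤ 1 by
      rw [le_div_iff₀ (by positivity)]
      refine le_trans (mul_le_mul_of_nonneg_left ?_ (sq_nonneg _)) h
      linarith [(Nat.cast_nonneg n : (0 : ℝ) ≤ n)]
    induction n with
    | zero => simp
    | succ n ih =>
      refine le_trans ?_ ih
      have h1 := congrArg (Nat.cast (R := ℝ)) n.succ_mul_centralBinom_succ
      push_cast at h1
      have h2 : ((n + 1).centralBinom : ℝ) / 4 ^ (n + 1) =
          (2 * n + 1) / (2 * n + 2) * (n.centralBinom / 4 ^ n) := by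
        rw [eq_div_of_mul_eq (by positivity) ((mul_comm _ _).trans h1)]
        field_simp
        ring
      rw [h2, mul_pow, mul_comm (((2 * n + 1 : ℝ) / (2 * n + 2)) ^ 2), mul_assoc]
      refine mul_le_mul_of_nonneg_left ?_ (sq_nonneg _)
      rw [div_pow, div_mul_eq_mul_div, div_le_iff₀ (by positivity)]
      push_cast
      nlinarith [(Nat.cast_nonneg n : (0 : ℝ) ≤ n)]
  have h2 : Tendsto (fun n : ℕ => ((n.centralBinom : ℝ) / 4 ^ n) ^ 2) atTop (𝓝 0) :=
    squeeze_zero (fun n => sq_nonneg _) h1 tendsto_one_div_add_atTop_nhds_zero_nat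
  have h3 := (Real.continuous_sqrt.tendsto 0).comp h2
  rw [Real.sqrt_zero] at h3
  exact h3.congr fun n => Real.sqrt_sq (by positivity)

/-- The partial sums telescope to `2 - 2 * centralBinom n / 4 ^ n`. -/
lemma hasSum_scaledCatalan : HasSum scaledCatalan 2 := by
  rw [hasSum_iff_tendsto_nat_of_nonneg fun n => (scaledCatalan_pos n).le]
  have h1 : ∀ n, ∑ i ∈ range n, scaledCatalan i = 2 - 2 * ((n.centralBinom : ℝ) / 4 ^ n) := by
    intro n
    induction n with
    | zero => simp
    | succ n ih =>
      have h1 := congrArg (Nat.cast (R := ℝ)) n.succ_mul_centralBinom_succ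
      push_cast at h1
      have h2 : ((n + 1).centralBinom : ℝ) = 2 * (2 * n + 1) * n.centralBinom / (n + 1) := by
        rw [← h1]
        field_simp
      rw [sum_range_succ, ih, scaledCatalan, ballotNum_zero_right, h2]
      field_simp
      ring
  simp only [h1]
  simpa using (tendsto_centralBinom_div.const_mul 2).const_sub 2

lemma summable_scaledCatalan : Summable scaledCatalan := hasSum_scaledCatalan.summable

lemma ballotNum_le (n j : ℕ) : ballotNum n j ≤ (2 * j + 1) * ballotNum n 0 := by
  rw [ballotNum_eq, ballotNum_zero_right, Nat.centralBinom_eq_two_mul_choose, div_mul_eq_mul_div,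
    mul_div_assoc']
  have h1 : ((2 * n).choose (n + j) : ℝ) ≤ (2 * n).choose n := by
    exact_mod_cast Nat.choose_le_centralBinom (n + j) n
  gcongr
  linarith [(Nat.cast_nonneg j : (0 : ℝ) ≤ j)]

lemma tendsto_ballotNum_zero_succ_div :
    Tendsto (fun n => ballotNum (n + 1) 0 / ballotNum n 0) atTop (𝓝 4) := by
  have h1 : ∀ n, ballotNum (n + 1) 0 / ballotNum n 0 = 4 * ((2 * n + 1) / (2 * n + 4)) := by
    intro n
    have h2 := scaledCatalan_succ n
    have h3 := ballotNum_zero_right_pos n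
    rw [scaledCatalan, scaledCatalan, pow_succ] at h2
    field_simp at h2 ⊢
    linarith
  simp only [h1]
  have h2 : Tendsto (fun n : ℕ => 4 * (1 - 3 / ((2 * n + 4 : ℕ) : ℝ))) atTop (𝓝 (4 * (1 - 0))) := by
    refine Tendsto.const_mul _ (Tendsto.const_sub _ ?_)
    refine Tendsto.div_atTop tendsto_const_nhds (tendsto_natCast_atTop_atTop.comp ?_)
    exact tendsto_atTop_mono (fun n => by rw [id]; omega) tendsto_id
  simp only [sub_zero, mul_one] at h2
  refine h2.congr fun n => ?_
  push_cast
  field_simp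
  ring

/-- In the limit the three-term recursion in `j` says that second differences vanish, since
consecutive Catalan numbers have ratio tending to `4`. The values `1` and `3` start the progression.
-/
lemma tendsto_ballotNum_div (j : ℕ) :
    Tendsto (fun n => ballotNum n j / ballotNum n 0) atTop (𝓝 (2 * j + 1)) := by
  have h0 : Tendsto (fun n => ballotNum n 0 / ballotNum n 0) atTop (𝓝 1) :=
    tendsto_const_nhds.congr fun n => (div_self (ballotNum_zero_right_pos n).ne').symm
  have h1 : Tendsto (fun n => ballotNum n 1 / ballotNum n 0) atTop (𝓝 3) := by
    have := tendsto_ballotNum_zero_succ_div.sub h0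
    norm_num at this
    refine this.congr fun n => ?_
    rw [ballotNum_succ_zero]
    ring
  have key : Tendsto (fun n => ballotNum n j / ballotNum n 0) atTop (𝓝 (2 * j + 1)) ∧
      Tendsto (fun n => ballotNum n (j + 1) / ballotNum n 0) atTop (𝓝 (2 * (j + 1 : ℕ) + 1)) := by
    induction j with
    | zero =>
      refine ⟨by simpa using h0, ?_⟩
      norm_num
      exact h1
    | succ j ih =>
      refine ⟨ih.2, ?_⟩
      have h3 := ((((tendsto_add_atTop_iff_nat 1).2 ih.2).mul
        tendsto_ballotNum_zero_succ_div).sub ih.1).sub (ih.2.const_mul 2)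
      have h4 : (2 * ((j + 1 : ℕ) : ℝ) + 1) * 4 - (2 * j + 1) - 2 * (2 * ((j + 1 : ℕ) : ℝ) + 1) =
          2 * ((j + 1 + 1 : ℕ) : ℝ) + 1 := by push_cast; ring
      rw [h4] at h3
      refine h3.congr fun n => ?_
      rw [ballotNum_succ_succ]
      have := ballotNum_zero_right_pos n
      have := ballotNum_zero_right_pos (n + 1)
      field_simp
      ring
  exact key.1

lemma tendsto_ballotNum_sub_div (s j : ℕ) :
    Tendsto (fun n => ballotNum (n - s) j / ballotNum n 0) atTop (𝓝 ((2 * j + 1) * (1 / 4) ^ s)) := by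
  induction s with
  | zero => simpa using tendsto_ballotNum_div j
  | succ s ih =>
    rw [← tendsto_add_atTop_iff_nat 1]
    have := ih.mul (tendsto_ballotNum_zero_succ_div.inv₀ (by norm_num))
    refine (this.congr fun n => ?_).trans (by rw [pow_succ]; norm_num [mul_assoc])
    have h1 : n + 1 - (s + 1) = n - s := by omega
    rw [h1]
    have := ballotNum_zero_right_pos n
    have := ballotNum_zero_right_pos (n + 1)
    field_simp

lemma summable_ballotNum (j : ℕ) : Summable fun n => ballotNum n j / 4 ^ n := by
  refine Summable.of_nonneg_of_le (fun n => div_nonneg (ballotNum_nonneg n j) (by positivity))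
    (fun n => ?_) (summable_scaledCatalan.mul_left (2 * j + 1 : ℝ))
  rw [scaledCatalan, mul_div_assoc']
  gcongr
  exact ballotNum_le n j

/-- Summing the recursion over `n` shows that the column sums form an arithmetic progression in `j`;
the first two both equal `2`. -/
lemma tsum_ballotNum (j : ℕ) : ∑' n, ballotNum n j / 4 ^ n = 2 := by
  have h0 : ∑' n, ballotNum n 0 / 4 ^ n = 2 := hasSum_scaledCatalan.tsum_eq
  have h1 : ∑' n, ballotNum n 1 / 4 ^ n = 2 := by
    have h2 := (summable_ballotNum 0).tsum_eq_zero_add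
    have h3 : ∀ n, ballotNum (n + 1) 0 / 4 ^ (n + 1) =
        1 / 4 * (ballotNum n 0 / 4 ^ n) + 1 / 4 * (ballotNum n 1 / 4 ^ n) := by
      intro n
      rw [ballotNum_succ_zero, pow_succ]
      field_simp
    simp only [h3] at h2
    rw [((summable_ballotNum 0).mul_left _).tsum_add ((summable_ballotNum 1).mul_left _),
      tsum_mul_left, tsum_mul_left, h0] at h2
    have h4 : ballotNum 0 0 = 1 := by simp [ballotNum, ballot]
    rw [h4] at h2
    linarith
  have key : ∑' n, ballotNum n j / 4 ^ n = 2 ∧ ∑' n, ballotNum n (j + 1) / 4 ^ n = 2 := by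
    induction j with
    | zero => exact ⟨h0, h1⟩
    | succ j ih =>
      refine ⟨ih.2, ?_⟩
      have h2 := (summable_ballotNum (j + 1)).tsum_eq_zero_add
      have h3 : ∀ n, ballotNum (n + 1) (j + 1) / 4 ^ (n + 1) =
          1 / 4 * (ballotNum n j / 4 ^ n) + 1 / 2 * (ballotNum n (j + 1) / 4 ^ n) +
          1 / 4 * (ballotNum n (j + 2) / 4 ^ n) := by
        intro n
        rw [ballotNum_succ_succ]
        field_simp
        ring
      simp only [h3] at h2
      rw [(((summable_ballotNum j).mul_left _).add
        ((summable_ballotNum (j + 1)).mul_left _)).tsum_add ((summable_ballotNum (j + 2)).mul_left _),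
        ((summable_ballotNum j).mul_left _).tsum_add ((summable_ballotNum (j + 1)).mul_left _),
        tsum_mul_left, tsum_mul_left, tsum_mul_left, ih.1, ih.2,
        ballotNum_eq_zero (show 0 < j + 1 by omega)] at h2
      have h5 : j + 1 + 1 = j + 2 := rfl
      rw [h5]
      linarith
  exact key.1

end ChordCount

namespace ChordCount

/-! ### Positivity of the odd theta series. -/

open Finset

lemma summable_mul_pow_choose (A : ℝ) {x : ℝ} (hx0 : 0 ≤ x) (hx1 : x < 1) :
    Summable fun j : ℕ => (2 * j + 1 : ℝ) * A ^ j * x ^ (j + 1).choose 2 := by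
  refine summable_of_ratio_norm_eventually_le (r := 1 / 2) (by norm_num) ?_
  have h1 : Tendsto (fun j : ℕ => 3 * |A| * x ^ (j + 1)) atTop (𝓝 (3 * |A| * 0)) :=
    ((tendsto_add_atTop_iff_nat 1).2 (tendsto_pow_atTop_nhds_zero_of_lt_one hx0 hx1)).const_mul _
  rw [mul_zero] at h1
  filter_upwards [h1.eventually (gt_mem_nhds (show (0 : ℝ) < 1 / 2 by norm_num))] with j hj
  rw [choose_two_succ]
  simp only [norm_mul, norm_pow, Real.norm_eq_abs, abs_of_nonneg hx0]
  have h2 : |(2 * ((j + 1 : ℕ) : ℝ) + 1)| ≤ 3 * |(2 * (j : ℝ) + 1)| := by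
    rw [abs_of_nonneg (by positivity), abs_of_nonneg (by positivity)]
    push_cast
    linarith [(Nat.cast_nonneg j : (0 : ℝ) ≤ j)]
  calc |(2 * ((j + 1 : ℕ) : ℝ) + 1)| * |A| ^ (j + 1) * x ^ ((j + 1).choose 2 + (j + 1))
      ≤ 3 * |(2 * (j : ℝ) + 1)| * |A| ^ (j + 1) * x ^ ((j + 1).choose 2 + (j + 1)) := by gcongr
    _ = 3 * |A| * x ^ (j + 1) * (|(2 * (j : ℝ) + 1)| * |A| ^ j * x ^ (j + 1).choose 2) := by ring
    _ ≤ _ := mul_le_mul_of_nonneg_right hj.le (by positivity)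

lemma summable_odd_mul_pow_choose {x : ℝ} (hx0 : 0 ≤ x) (hx1 : x < 1) :
    Summable fun j : ℕ => (2 * j + 1 : ℝ) * x ^ (j + 1).choose 2 := by
  simpa using summable_mul_pow_choose 1 hx0 hx1

/-- The theta series `∑ (-1)^j (2j+1) x^(j+1 choose 2)`. -/
noncomputable def oddTheta (x : ℝ) : ℝ := ∑' j : ℕ, (-1) ^ j * (2 * j + 1) * x ^ (j + 1).choose 2

section oddTheta

variable {x : ℝ} (hx0 : 0 ≤ x) (hx1 : x < 1)

include hx0 hx1

lemma abs_prod_one_sub_pow_le (s : Finset ℕ) (e : ℕ → ℕ) : |∏ i ∈ s, (1 - x ^ e i)| ≤ 1 := by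
  rw [abs_prod]
  refine prod_le_one (fun _ _ => abs_nonneg _) fun i _ => ?_
  have := pow_le_one₀ (n := e i) hx0 hx1.le
  have := pow_nonneg hx0 (e i)
  rw [abs_le]
  constructor <;> linarith

lemma abs_thetaCoeff_le (h j : ℕ) : |thetaCoeff x h j| ≤ x ^ (j + 1).choose 2 := by
  rw [thetaCoeff, abs_mul, abs_mul, abs_pow, abs_neg, abs_one, one_pow, one_mul,
    abs_of_nonneg (pow_nonneg hx0 _)]
  exact mul_le_of_le_one_right (by positivity) (abs_prod_one_sub_pow_le hx0 hx1 _ _)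

lemma summable_thetaCoeff_mul (h a : ℕ) :
    Summable fun j : ℕ => thetaCoeff x h j * (a + 2 * j : ℝ) := by
  refine Summable.of_norm_bounded ((summable_odd_mul_pow_choose hx0 hx1).mul_left (a + 1 : ℝ))
    fun j => ?_
  rw [Real.norm_eq_abs, abs_mul, abs_of_nonneg (show (0 : ℝ) ≤ a + 2 * j by positivity)]
  calc |thetaCoeff x h j| * (a + 2 * j : ℝ)
      ≤ x ^ (j + 1).choose 2 * ((a + 1) * (2 * j + 1)) := by
        refine mul_le_mul (abs_thetaCoeff_le hx0 hx1 h j) ?_ (by positivity) (by positivity)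
        nlinarith [(Nat.cast_nonneg j : (0 : ℝ) ≤ j), (Nat.cast_nonneg a : (0 : ℝ) ≤ a),
          mul_nonneg (Nat.cast_nonneg j : (0 : ℝ) ≤ j) (Nat.cast_nonneg a : (0 : ℝ) ≤ a)]
    _ = _ := by ring

/-- The factor `h + 1 + 2 j` is linear in the height, as are the limiting ballot ratios, so the
finite identity `sum_thetaCoeff_succ` passes to the limit once its boundary term vanishes. -/
lemma tsum_thetaCoeff_mul_succ (h : ℕ) :
    ∑' j : ℕ, thetaCoeff x (h + 2) j * ((h + 2 + 1 : ℕ) + 2 * j : ℝ) =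
      2 * ∑' j : ℕ, thetaCoeff x (h + 1) j * ((h + 1 + 1 : ℕ) + 2 * j : ℝ) -
        (1 - x ^ (h + 1)) * ∑' j : ℕ, thetaCoeff x h j * ((h + 1 : ℕ) + 2 * j : ℝ) := by
  have h1 := (summable_thetaCoeff_mul hx0 hx1 h (h + 1)).hasSum.tendsto_sum_nat.comp
    (tendsto_add_atTop_nat 1)
  have h2 := (summable_thetaCoeff_mul hx0 hx1 (h + 1) (h + 1 + 1)).hasSum.tendsto_sum_nat.comp
    (tendsto_add_atTop_nat 1)
  have h3 := (summable_thetaCoeff_mul hx0 hx1 (h + 2) (h + 2 + 1)).hasSum.tendsto_sum_nat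
  have h4 := (summable_thetaCoeff_mul hx0 hx1 (h + 1) (h + 2 + 1)).tendsto_atTop_zero
  refine tendsto_nhds_unique h3 ?_
  have h5 := ((h2.const_mul 2).sub (h1.const_mul (1 - x ^ (h + 1)))).sub h4
  rw [sub_zero] at h5
  refine h5.congr fun J => ?_
  have h6 := sum_thetaCoeff_succ x (fun j => ((h + 1 : ℕ) + 2 * j : ℝ)) h J
  simp only [Function.comp]
  have h7 : ∀ j, thetaCoeff x (h + 1) j *
      (((h + 1 : ℕ) + 2 * (j : ℝ)) + ((h + 1 : ℕ) + 2 * ((j + 1 : ℕ) : ℝ))) =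
      2 * (thetaCoeff x (h + 1) j * ((h + 1 + 1 : ℕ) + 2 * j : ℝ)) := by
    intro j; push_cast; ring
  have h8 : ∀ j, ((h + 1 : ℕ) + 2 * ((j + 1 : ℕ) : ℝ)) = ((h + 2 + 1 : ℕ) + 2 * j : ℝ) := by
    intro j; push_cast; ring
  simp only [h7, ← mul_sum] at h6
  simp only [h8] at h6
  linarith

lemma tsum_thetaCoeff_one : ∑' j : ℕ, thetaCoeff x 1 j * ((1 + 1 : ℕ) + 2 * j : ℝ) =
    2 * ∑' j : ℕ, thetaCoeff x 0 j * ((0 + 1 : ℕ) + 2 * j : ℝ) := by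
  have h2 := (summable_thetaCoeff_mul hx0 hx1 0 (0 + 1)).hasSum.tendsto_sum_nat.comp
    (tendsto_add_atTop_nat 1)
  have h3 := (summable_thetaCoeff_mul hx0 hx1 1 (1 + 1)).hasSum.tendsto_sum_nat
  have h4 := (summable_thetaCoeff_mul hx0 hx1 0 (1 + 1)).tendsto_atTop_zero
  refine tendsto_nhds_unique h3 ?_
  have h5 := (h2.const_mul 2).sub h4
  rw [sub_zero] at h5
  refine h5.congr fun J => ?_
  have h6 := sum_thetaCoeff_zero x (fun j => (2 * j : ℝ)) J
  simp only [Function.comp]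
  have h7 : ∀ j : ℕ, thetaCoeff x 0 j * (2 * (j : ℝ) + 2 * ((j + 1 : ℕ) : ℝ)) =
      2 * (thetaCoeff x 0 j * ((0 + 1 : ℕ) + 2 * j : ℝ)) := by
    intro j; push_cast; ring
  have h8 : ∀ j : ℕ, 2 * ((j + 1 : ℕ) : ℝ) = ((1 + 1 : ℕ) + 2 * j : ℝ) := by
    intro j; push_cast; ring
  simp only [h7, ← mul_sum] at h6
  simp only [h8] at h6
  simp only [Nat.cast_zero, mul_zero] at h6
  linarith

lemma one_sub_pow_le_prod (j : ℕ) : (1 - x) ^ j ≤ ∏ i ∈ range j, (1 - x ^ (i + 1)) := by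
  rw [← card_range j, ← prod_const, card_range]
  refine prod_le_prod (fun _ _ => by linarith) fun i _ => ?_
  have := pow_le_of_le_one hx0 hx1.le (show i + 1 ≠ 0 by omega)
  linarith

lemma prod_one_sub_pow_pos (j : ℕ) : 0 < ∏ i ∈ range j, (1 - x ^ (i + 1)) :=
  prod_pos fun i _ => sub_pos.2 (pow_lt_one₀ hx0 hx1 (by omega))

lemma abs_div_prod_le {a : ℝ} (j : ℕ) (ha : |a| ≤ x ^ (j + 1).choose 2) :
    |a / ∏ i ∈ range j, (1 - x ^ (i + 1))| ≤ (1 - x)⁻¹ ^ j * x ^ (j + 1).choose 2 := by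
  have h1 : 0 < (1 - x) ^ j := pow_pos (by linarith) j
  rw [abs_div, abs_of_pos (prod_one_sub_pow_pos hx0 hx1 j), inv_pow, mul_comm, ← div_eq_mul_inv]
  exact div_le_div₀ (by positivity) ha h1 (one_sub_pow_le_prod hx0 hx1 j)

lemma summable_inv_pow_mul : Summable fun j : ℕ => (1 - x)⁻¹ ^ j * x ^ (j + 1).choose 2 := by
  have h1 : 0 < (1 - x)⁻¹ := inv_pos.2 (by linarith)
  refine Summable.of_nonneg_of_le (fun j => by positivity) (fun j => ?_)
    (summable_mul_pow_choose (1 - x)⁻¹ hx0 hx1)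
  rw [mul_assoc]
  exact le_mul_of_one_le_left (by positivity) (by linarith [(Nat.cast_nonneg j : (0 : ℝ) ≤ j)])

lemma abs_qExp_le (N j : ℕ) :
    |(-1) ^ j * x ^ ((j + 1).choose 2 + N * j) / ∏ i ∈ range j, (1 - x ^ (i + 1))| ≤
      (1 - x)⁻¹ ^ j * x ^ (j + 1).choose 2 := by
  refine abs_div_prod_le hx0 hx1 j ?_
  rw [abs_mul, abs_pow, abs_neg, abs_one, one_pow, one_mul, abs_of_nonneg (pow_nonneg hx0 _)]
  exact pow_le_pow_of_le_one hx0 hx1.le (by omega)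

lemma summable_qExp (N : ℕ) : Summable fun j : ℕ =>
    (-1) ^ j * x ^ ((j + 1).choose 2 + N * j) / ∏ i ∈ range j, (1 - x ^ (i + 1)) :=
  Summable.of_norm_bounded (summable_inv_pow_mul hx0 hx1) (abs_qExp_le hx0 hx1 N)

/-- This is the functional equation of Euler's expansion of the product of `1 - x ^ i` over `i > N`.
With the limit `1` as `N → ∞` it yields positivity without identifying the product. -/
lemma tsum_qExp_eq (N : ℕ) :
    ∑' j : ℕ, (-1) ^ j * x ^ ((j + 1).choose 2 + N * j) / ∏ i ∈ range j, (1 - x ^ (i + 1)) =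
      (1 - x ^ (N + 1)) * ∑' j : ℕ,
        (-1) ^ j * x ^ ((j + 1).choose 2 + (N + 1) * j) / ∏ i ∈ range j, (1 - x ^ (i + 1)) := by
  have h1 := summable_qExp hx0 hx1 N
  have h2 := summable_qExp hx0 hx1 (N + 1)
  have h3 := (h1.sub h2).tsum_eq_zero_add
  rw [h1.tsum_sub h2] at h3
  have h4 : ∀ j : ℕ, (-1) ^ (j + 1) * x ^ ((j + 1 + 1).choose 2 + N * (j + 1)) /
      ∏ i ∈ range (j + 1), (1 - x ^ (i + 1)) -
      (-1) ^ (j + 1) * x ^ ((j + 1 + 1).choose 2 + (N + 1) * (j + 1)) /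
      ∏ i ∈ range (j + 1), (1 - x ^ (i + 1)) = -x ^ (N + 1) *
      ((-1) ^ j * x ^ ((j + 1).choose 2 + (N + 1) * j) / ∏ i ∈ range j, (1 - x ^ (i + 1))) := by
    intro j
    have h5 := (prod_one_sub_pow_pos hx0 hx1 j).ne'
    have h6 : 1 - x ^ (j + 1) ≠ 0 := (sub_pos.2 (pow_lt_one₀ hx0 hx1 (by omega))).ne'
    rw [prod_range_succ, choose_two_succ]
    field_simp
    ring
  simp only [h4, tsum_mul_left] at h3
  simp only [pow_zero, mul_zero, add_zero, sub_self, zero_add] at h3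
  linarith

lemma tendsto_tsum_qExp : Tendsto (fun N : ℕ => ∑' j : ℕ,
    (-1) ^ j * x ^ ((j + 1).choose 2 + N * j) / ∏ i ∈ range j, (1 - x ^ (i + 1)))
      atTop (𝓝 1) := by
  have h1 : ∑' j : ℕ, (if j = 0 then (1 : ℝ) else 0) = 1 := by
    rw [tsum_eq_single 0 (fun j hj => if_neg hj), if_pos rfl]
  suffices h : Tendsto (fun N : ℕ => ∑' j : ℕ,
      (-1) ^ j * x ^ ((j + 1).choose 2 + N * j) / ∏ i ∈ range j, (1 - x ^ (i + 1)))
      atTop (𝓝 (∑' j : ℕ, if j = 0 then (1 : ℝ) else 0)) by rwa [h1] at h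
  clear h1
  refine tendsto_tsum_of_dominated_convergence (summable_inv_pow_mul hx0 hx1) (fun j => ?_)
    (Eventually.of_forall fun N j => abs_qExp_le hx0 hx1 N j)
  rcases j with _ | j
  · simp
  · rw [if_neg (by omega)]
    have h2 : Tendsto (fun N : ℕ => (x ^ (j + 1)) ^ N) atTop (𝓝 0) :=
      tendsto_pow_atTop_nhds_zero_of_lt_one (by positivity) (pow_lt_one₀ hx0 hx1 (by omega))
    have h3 := h2.const_mul ((-1) ^ (j + 1) * x ^ (j + 1 + 1).choose 2 /
      ∏ i ∈ range (j + 1), (1 - x ^ (i + 1)))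
    rw [mul_zero] at h3
    refine h3.congr fun N => ?_
    rw [pow_add x _ (N * (j + 1)), ← pow_mul, mul_comm N]
    ring

lemma tsum_qExp_pos : 0 < ∑' j : ℕ,
    (-1) ^ j * x ^ (j + 1).choose 2 / ∏ i ∈ range j, (1 - x ^ (i + 1)) := by
  obtain ⟨N, hN⟩ := ((tendsto_tsum_qExp hx0 hx1).eventually
    (lt_mem_nhds (show (0 : ℝ) < 1 by norm_num))).exists
  have key : ∀ M, 0 < ∑' j : ℕ,
      (-1) ^ j * x ^ ((j + 1).choose 2 + M * j) / ∏ i ∈ range j, (1 - x ^ (i + 1)) →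
      0 < ∑' j : ℕ,
        (-1) ^ j * x ^ ((j + 1).choose 2 + 0 * j) / ∏ i ∈ range j, (1 - x ^ (i + 1)) := by
    intro M
    induction M with
    | zero => exact id
    | succ M ih =>
      intro h
      refine ih ?_
      rw [tsum_qExp_eq hx0 hx1]
      exact mul_pos (sub_pos.2 (pow_lt_one₀ hx0 hx1 (by omega))) h
  simpa using key N hN

omit hx0 hx1 in
lemma prod_mul_prod_one_sub_pow (h j : ℕ) :
    (∏ i ∈ range h, (1 - x ^ (j + i + 1))) * ∏ i ∈ range j, (1 - x ^ (i + 1)) =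
      (∏ i ∈ range h, (1 - x ^ (i + 1))) * ∏ i ∈ range j, (1 - x ^ (h + i + 1)) := by
  rw [← prod_range_add (fun i => 1 - x ^ (i + 1)) h j, mul_comm,
    ← prod_range_add (fun i => 1 - x ^ (i + 1)) j h, add_comm]

/-- Both `∏_{i<h} (1 - x ^ (j+i+1)) · ∏_{i<j} (1 - x ^ (i+1))` and the version with `h` and `j`
exchanged equal the product up to `h + j`. After the exchange, dominated convergence in `j` leaves
Euler's series. -/
lemma tendsto_tsum_thetaCoeff_div :
    Tendsto (fun h : ℕ => (∑' j : ℕ, thetaCoeff x h j * ((h + 1 : ℕ) + 2 * j : ℝ)) /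
      ((h + 1) * ∏ i ∈ range h, (1 - x ^ (i + 1)))) atTop
      (𝓝 (∑' j : ℕ, (-1) ^ j * x ^ (j + 1).choose 2 / ∏ i ∈ range j, (1 - x ^ (i + 1)))) := by
  have h1 : ∀ h j : ℕ, thetaCoeff x h j * ((h + 1 : ℕ) + 2 * j : ℝ) /
      ((h + 1) * ∏ i ∈ range h, (1 - x ^ (i + 1))) =
      ((-1) ^ j * x ^ (j + 1).choose 2 * ∏ i ∈ range j, (1 - x ^ (h + i + 1))) /
        (∏ i ∈ range j, (1 - x ^ (i + 1))) * (1 + 2 * j * (1 / ((h : ℝ) + 1))) := by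
    intro h j
    have h2 := (prod_one_sub_pow_pos hx0 hx1 j).ne'
    have h3 := (prod_one_sub_pow_pos hx0 hx1 h).ne'
    have h4 := prod_mul_prod_one_sub_pow (x := x) h j
    have h5 : (h : ℝ) + 1 ≠ 0 := by positivity
    rw [thetaCoeff, div_mul_eq_mul_div, div_eq_div_iff (mul_ne_zero h5 h3) h2]
    push_cast
    generalize (-1) ^ j * x ^ (j + 1).choose 2 = c
    field_simp
    linear_combination c * h4
  simp only [← tsum_div_const, h1]
  refine tendsto_tsum_of_dominated_convergence (bound := fun j : ℕ =>
    (2 * j + 1) * (1 - x)⁻¹ ^ j * x ^ (j + 1).choose 2)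
    (summable_mul_pow_choose (1 - x)⁻¹ hx0 hx1) (fun j => ?_) (Eventually.of_forall fun h j => ?_)
  · have h2 : Tendsto (fun h : ℕ => 1 + 2 * j * (1 / ((h : ℝ) + 1))) atTop (𝓝 (1 + 2 * j * 0)) :=
      (tendsto_one_div_add_atTop_nhds_zero_nat.const_mul _).const_add 1
    have h3 : Tendsto (fun h : ℕ => ∏ i ∈ range j, (1 - x ^ (h + i + 1))) atTop
        (𝓝 (∏ i ∈ range j, (1 - 0))) := by
      refine tendsto_finsetProd _ fun i _ => Tendsto.const_sub 1 ?_
      exact (tendsto_add_atTop_iff_nat (f := fun n => x ^ n) (i + 1)).2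
        (tendsto_pow_atTop_nhds_zero_of_lt_one hx0 hx1)
    have h4 := ((h3.const_mul ((-1) ^ j * x ^ (j + 1).choose 2)).div_const
      (∏ i ∈ range j, (1 - x ^ (i + 1)))).mul h2
    simpa using h4
  · rw [norm_mul, Real.norm_eq_abs, Real.norm_eq_abs]
    have h2 : |1 + 2 * (j : ℝ) * (1 / ((h : ℝ) + 1))| ≤ 2 * j + 1 := by
      rw [abs_of_nonneg (by positivity)]
      have : 1 / ((h : ℝ) + 1) ≤ 1 := by
        rw [div_le_one (by positivity)]
        linarith [(Nat.cast_nonneg h : (0 : ℝ) ≤ h)]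
      nlinarith [(Nat.cast_nonneg j : (0 : ℝ) ≤ j)]
    have h3 : |(-1) ^ j * x ^ (j + 1).choose 2 * ∏ i ∈ range j, (1 - x ^ (h + i + 1))| ≤
        x ^ (j + 1).choose 2 := by
      rw [abs_mul, abs_mul, abs_pow, abs_neg, abs_one, one_pow, one_mul,
        abs_of_nonneg (pow_nonneg hx0 _)]
      exact mul_le_of_le_one_right (by positivity)
        (abs_prod_one_sub_pow_le hx0 hx1 _ fun i => h + i + 1)
    have h4 := abs_div_prod_le hx0 hx1 j h3
    refine (mul_le_mul h4 h2 (abs_nonneg _) ((abs_nonneg _).trans h4)).trans (le_of_eq ?_)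
    ring

/-- If `B 0 ≤ 0`, the recursion `B (h + 2) = 2 B (h + 1) - (1 - x ^ (h + 1)) B h` keeps `B`
nonpositive and decreasing, so the normalized limit would be at most `0`. But that limit is Euler's
series, which is positive. -/
lemma oddTheta_pos : 0 < oddTheta x := by
  by_contra hneg
  rw [not_lt] at hneg
  set B : ℕ → ℝ := fun h => ∑' j : ℕ, thetaCoeff x h j * ((h + 1 : ℕ) + 2 * j : ℝ) with hB
  have hB0 : B 0 ≤ 0 := by
    refine le_of_eq_of_le ?_ hneg
    refine tsum_congr fun j => ?_
    simp [thetaCoeff]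
    ring
  have hB1 : ∀ h, B h ≤ 0 ∧ B (h + 1) ≤ B h := by
    intro h
    induction h with
    | zero =>
      refine ⟨hB0, ?_⟩
      have : B 1 = 2 * B 0 := tsum_thetaCoeff_one hx0 hx1
      rw [zero_add, this]
      linarith
    | succ h ih =>
      have h1 : B (h + 2) = 2 * B (h + 1) - (1 - x ^ (h + 1)) * B h :=
        tsum_thetaCoeff_mul_succ hx0 hx1 h
      refine ⟨ih.2.trans ih.1, ?_⟩
      have h2 : x ^ (h + 1) * B h ≤ 0 := mul_nonpos_of_nonneg_of_nonpos (by positivity) ih.1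
      change B (h + 2) ≤ _
      rw [h1]
      linarith [ih.2]
  have h1 := le_of_tendsto' (tendsto_tsum_thetaCoeff_div hx0 hx1) fun h =>
    div_nonpos_of_nonpos_of_nonneg (hB1 h).1
      (mul_nonneg (by positivity) (prod_one_sub_pow_pos hx0 hx1 h).le)
  exact absurd (tsum_qExp_pos hx0 hx1) (not_lt.2 h1)

end oddTheta

end ChordCount

namespace ChordCount

/-! ### Coefficientwise domination and the expansion of powers of the uncut series. -/

open Finset Polynomial

/-- Coefficientwise domination of a double series by a series with nonnegative coefficients. -/
def Majorized (a b : PowerSeries ℝ[X]) : Prop :=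
  ∀ n i, |(PowerSeries.coeff n a).coeff i| ≤ (PowerSeries.coeff n b).coeff i

namespace Majorized

variable {a b c d : PowerSeries ℝ[X]}

lemma trans (h : Majorized a b) (h' : Majorized b c) : Majorized a c := fun n i =>
  (h n i).trans ((le_abs_self _).trans (h' n i))

lemma add (h : Majorized a b) (h' : Majorized c d) : Majorized (a + c) (b + d) := fun n i => by
  simp only [map_add, coeff_add]
  exact (abs_add_le _ _).trans (add_le_add (h n i) (h' n i))

lemma neg (h : Majorized a b) : Majorized (-a) b := fun n i => by
  simpa using h n i

lemma sub (h : Majorized a b) (h' : Majorized c d) : Majorized (a - c) (b + d) := by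
  rw [sub_eq_add_neg]
  exact h.add h'.neg

lemma mul (h : Majorized a b) (h' : Majorized c d) : Majorized (a * c) (b * d) := fun n i => by
  simp only [PowerSeries.coeff_mul, finsetSum_coeff, coeff_mul]
  refine (abs_sum_le_sum_abs _ _).trans (sum_le_sum fun p _ => ?_)
  refine (abs_sum_le_sum_abs _ _).trans (sum_le_sum fun r _ => ?_)
  rw [abs_mul]
  exact mul_le_mul (h _ _) (h' _ _) (abs_nonneg _) ((abs_nonneg _).trans (h _ _))

lemma one : Majorized 1 1 := fun n i => by
  rw [PowerSeries.coeff_one]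
  split_ifs
  · rw [coeff_one]
    split_ifs <;> simp
  · simp

lemma zero : Majorized 0 0 := fun n i => by simp

lemma natCast (k : ℕ) : Majorized (k : PowerSeries ℝ[X]) k := by
  induction k with
  | zero => simpa using zero
  | succ k ih => simpa using ih.add one

lemma pow (h : Majorized a b) (k : ℕ) : Majorized (a ^ k) (b ^ k) := by
  induction k with
  | zero => simpa using one
  | succ k ih => simpa only [pow_succ] using ih.mul h

lemma right_add (h : Majorized a b) (h' : Majorized c c) : Majorized a (b + c) := fun n i => by
  simp only [map_add, coeff_add]
  linarith [h n i, (abs_nonneg _).trans (h' n i)]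

end Majorized

lemma coeff_firstPassage_nonneg (k : ℕ) : ∀ h i, 0 ≤ (firstPassage (X : ℝ[X]) k h).coeff i := by
  induction k with
  | zero =>
    rintro (_ | h) i
    · rw [firstPassage, coeff_one]
      split_ifs <;> simp
    · simp [firstPassage]
  | succ k ih =>
    rintro (_ | h) i
    · simp [firstPassage]
    · rw [firstPassage, coeff_add, coeff_mul]
      refine add_nonneg (ih _ _) (sum_nonneg fun p _ => mul_nonneg ?_ (ih _ _))
      rw [finsetSum_coeff]
      refine sum_nonneg fun l _ => ?_
      rw [coeff_X_pow]
      split_ifs <;> simp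

lemma majorized_uncutSeries : Majorized uncutSeries uncutSeries := fun n i => by
  refine (abs_of_nonneg ?_).le
  rcases n with _ | n
  · simp [uncutSeries]
  · simpa [uncutSeries] using coeff_firstPassage_nonneg _ _ _

lemma majorized_chordSeries : Majorized chordSeries chordSeries := fun n i => by
  refine (abs_of_nonneg ?_).le
  rw [chordSeries, matchingSeries, PowerSeries.coeff_mk, openSum, matchingSum, finsetSum_coeff]
  refine sum_nonneg fun f _ => ?_
  rw [mul_one, coeff_X_pow]
  split_ifs <;> simp

lemma one_majorized_chordSeries : Majorized 1 chordSeries := by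
  rw [chordSeries_eq]
  exact Majorized.one.right_add (majorized_uncutSeries.mul majorized_chordSeries)

lemma uncutSeries_majorized_chordSeries : Majorized uncutSeries chordSeries := by
  have h1 := majorized_uncutSeries.mul one_majorized_chordSeries
  rw [mul_one] at h1
  rw [chordSeries_eq, add_comm]
  exact h1.right_add Majorized.one

/-- The inverse of the generating series of all matchings. -/
noncomputable def invSeries : PowerSeries ℝ[X] := 1 - uncutSeries

lemma invSeries_mul_chordSeries : invSeries * chordSeries = 1 := by
  rw [invSeries, sub_mul, one_mul]
  nth_rewrite 1 [chordSeries_eq]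
  ring

lemma invSeries_majorized_chordSeries : Majorized invSeries chordSeries := fun n i => by
  rcases n with _ | n
  · have : PowerSeries.coeff 0 invSeries = PowerSeries.coeff 0 (1 : PowerSeries ℝ[X]) := by
      simp [invSeries, uncutSeries]
    rw [this]
    exact one_majorized_chordSeries 0 i
  · have : PowerSeries.coeff (n + 1) invSeries = - PowerSeries.coeff (n + 1) uncutSeries := by
      simp [invSeries, PowerSeries.coeff_one]
    rw [this, coeff_neg, abs_neg]
    exact uncutSeries_majorized_chordSeries (n + 1) i

/-- The part of a series of order at least `k`. -/
noncomputable def tailSeries {R : Type*} [Semiring R] (k : ℕ) (a : PowerSeries R) :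
    PowerSeries R :=
  PowerSeries.mk fun n => if n < k then 0 else PowerSeries.coeff n a

lemma sub_trunc_eq_tailSeries {R : Type*} [CommRing R] (k : ℕ) (a : PowerSeries R) :
    a - (PowerSeries.trunc k a : R[X]) = tailSeries k a := by
  ext1 n
  rw [map_sub, tailSeries, PowerSeries.coeff_mk, Polynomial.coeff_coe, PowerSeries.coeff_trunc]
  split_ifs <;> simp

lemma Majorized.tailSeries {a b : PowerSeries ℝ[X]} (h : Majorized a b) (k : ℕ) :
    Majorized (tailSeries k a) (tailSeries k b) := fun n i => by
  rw [ChordCount.tailSeries, ChordCount.tailSeries, PowerSeries.coeff_mk, PowerSeries.coeff_mk]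
  split_ifs
  · simp
  · exact h n i

lemma Majorized.trunc {a b : PowerSeries ℝ[X]} (h : Majorized a b) (k : ℕ) :
    Majorized (PowerSeries.trunc k a : ℝ[X][X]) b := fun n i => by
  rw [Polynomial.coeff_coe, PowerSeries.coeff_trunc]
  split_ifs
  · exact h n i
  · simpa using (abs_nonneg _).trans (h n i)

lemma chordSeries_pow_majorized (k : ℕ) : Majorized (chordSeries ^ k) (chordSeries ^ (k + 1)) := by
  have := (majorized_chordSeries.pow k).mul one_majorized_chordSeries
  rwa [mul_one, ← pow_succ] at this

/-- A Taylor expansion to second order in `d`. The point is that `c` depends on `j` alone, hence not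
on the later truncation. -/
lemma exists_pow_sub_eq (j : ℕ) : ∃ c : ℕ, ∀ u d : PowerSeries ℝ[X],
    Majorized u (2 * chordSeries) → Majorized (u - d) chordSeries →
    ∃ W, (u - d) ^ (j + 1) = u ^ (j + 1) - (j + 1) * u ^ j * d + d ^ 2 * W ∧
      Majorized W (c * chordSeries ^ j) := by
  induction j with
  | zero =>
    refine ⟨0, fun u d _ _ => ⟨0, by simp, ?_⟩⟩
    simpa using Majorized.zero
  | succ j ih =>
    obtain ⟨c, hc⟩ := ih
    refine ⟨c + (j + 1) * 2 ^ j, fun u d hu hud => ?_⟩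
    obtain ⟨W, hW1, hW2⟩ := hc u d hu hud
    refine ⟨W * (u - d) + (j + 1 : ℕ) * u ^ j, ?_, ?_⟩
    · rw [pow_succ (u - d), hW1]
      push_cast
      ring
    · have h1 := hW2.mul hud
      have h2 := (Majorized.natCast (j + 1)).mul ((hu.pow j).trans (by
        rw [mul_pow]
        exact ((Majorized.natCast 2).pow j).mul (chordSeries_pow_majorized j)))
      have h3 := h1.add h2
      have h4 : (c : PowerSeries ℝ[X]) * chordSeries ^ j * chordSeries +
          ((j + 1 : ℕ) : PowerSeries ℝ[X]) * (((2 : ℕ) : PowerSeries ℝ[X]) ^ j *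
            chordSeries ^ (j + 1)) =
          ((c + (j + 1) * 2 ^ j : ℕ) : PowerSeries ℝ[X]) * chordSeries ^ (j + 1) := by
        push_cast
        ring
      rw [h4] at h3
      exact h3

/-- Up to a polynomial, powers of the series of matchings without cuts agree with a polynomial
multiple of the series of all matchings, with an error in which two components are large. -/
lemma exists_uncutSeries_pow_eq (j : ℕ) : ∃ c : ℕ, ∀ k : ℕ, ∃ (P : ℝ[X][X])
    (R : PowerSeries ℝ[X]), uncutSeries ^ (j + 1) = P +
      ((((j + 1) * (1 - PowerSeries.trunc k invSeries) ^ j *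
        PowerSeries.trunc k invSeries ^ 2 : ℝ[X][X])) : PowerSeries ℝ[X]) * chordSeries + R ∧
      Majorized R (c * (tailSeries k chordSeries ^ 2 * chordSeries ^ (j + 1))) := by
  obtain ⟨c, hc⟩ := exists_pow_sub_eq j
  refine ⟨c + (j + 1) * 2 ^ j, fun k => ?_⟩
  set E := PowerSeries.trunc k invSeries with hE
  set e : PowerSeries ℝ[X] := (E : PowerSeries ℝ[X]) with he
  set d := tailSeries k invSeries with hd
  have hed : invSeries - e = d := sub_trunc_eq_tailSeries k invSeries
  have he1 : Majorized e chordSeries := invSeries_majorized_chordSeries.trunc k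
  have hd1 : Majorized d (tailSeries k chordSeries) := invSeries_majorized_chordSeries.tailSeries k
  have hu : Majorized (1 - e) (2 * chordSeries) := by
    rw [two_mul]
    exact one_majorized_chordSeries.sub he1
  have hI : uncutSeries = 1 - e - d := by
    rw [← hed, invSeries]
    ring
  obtain ⟨W, hW1, hW2⟩ := hc (1 - e) d hu (by
    rw [← hI]
    exact uncutSeries_majorized_chordSeries)
  -- Expand `d T d` with `d = I - e` and `I T = 1`. This trades the unbounded tail `d` in the linear
  -- term for a polynomial, the multiple `e ^ 2 T` of `T`, and a term quadratic in `d`.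
  have hdd : d = e - e * chordSeries * e + d * chordSeries * d := by
    rw [← hed]
    linear_combination (2 * e - invSeries) * invSeries_mul_chordSeries
  refine ⟨(1 - E) ^ (j + 1) - (j + 1) * (1 - E) ^ j * E,
    d ^ 2 * (W - (j + 1 : ℕ) * ((1 - e) ^ j * chordSeries)), ?_, ?_⟩
  · rw [hI, hW1]
    push_cast
    have hj : ((j : ℝ[X][X]) : PowerSeries ℝ[X]) = j :=
      map_natCast (Polynomial.coeToPowerSeries.ringHom (R := ℝ[X])) j
    rw [← he, hj]
    linear_combination (-(j + 1) * (1 - e) ^ j) * hdd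
  · have h1 := hW2.trans ((Majorized.natCast c).mul (chordSeries_pow_majorized j))
    have h2 := (Majorized.natCast (j + 1)).mul ((hu.pow j).mul majorized_chordSeries)
    have h3 := (hd1.pow 2).mul (h1.sub h2)
    have h4 : tailSeries k chordSeries ^ 2 * ((c : PowerSeries ℝ[X]) * chordSeries ^ (j + 1) +
        ((j + 1 : ℕ) : PowerSeries ℝ[X]) * ((2 * chordSeries) ^ j * chordSeries)) =
        ((c + (j + 1) * 2 ^ j : ℕ) : PowerSeries ℝ[X]) *
          (tailSeries k chordSeries ^ 2 * chordSeries ^ (j + 1)) := by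
      push_cast
      ring
    rw [h4] at h3
    exact h3

end ChordCount

namespace ChordCount

/-! ### Extracting the coefficient of `x ^ m`, and bounding the error. -/

open Finset Polynomial

/-- The coefficient of `x^m` in `(1 - x)^(-n)`, for `n ≥ 1`. -/
def negBinom (n m : ℕ) : ℝ := (n - 1 + m).choose (n - 1)

lemma negBinom_pos (n m : ℕ) : 0 < negBinom n m := by
  unfold negBinom
  exact_mod_cast Nat.choose_pos (by omega)

lemma succ_mul_negBinom {n : ℕ} (hn : 0 < n) (m : ℕ) :
    (m + 1) * negBinom n (m + 1) = (n + m) * negBinom n m := by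
  obtain ⟨n, rfl⟩ : ∃ n', n = n' + 1 := ⟨n - 1, by omega⟩
  have h1 := Nat.add_one_mul_choose_eq (n + m) m
  have h2 : (n + (m + 1)).choose n = (n + m + 1).choose (m + 1) :=
    Nat.choose_symm_of_eq_add (by omega)
  have h3 : (n + m).choose n = (n + m).choose m := Nat.choose_symm_of_eq_add (by omega)
  simp only [negBinom, Nat.add_sub_cancel]
  rw [h2, h3]
  have h4 := congrArg (Nat.cast (R := ℝ)) h1
  push_cast at h4 ⊢
  linarith

/-- The ratio `negBinom n (m - i) / negBinom n m`. -/
noncomputable def negBinomRatio (n m i : ℕ) : ℝ :=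
  ∏ t ∈ range i, ((m - t : ℝ) / (n + m - 1 - t))

lemma negBinomRatio_eq_zero (n : ℕ) {m i : ℕ} (h : m < i) : negBinomRatio n m i = 0 :=
  prod_eq_zero (Finset.mem_range.2 h) (by simp)

lemma negBinom_sub {n : ℕ} (hn : 0 < n) (m i : ℕ) (hi : i ≤ m) :
    negBinom n (m - i) = negBinom n m * negBinomRatio n m i := by
  induction i with
  | zero => simp [negBinomRatio]
  | succ i ih =>
    obtain ⟨l, rfl⟩ : ∃ l, m = l + i + 1 := ⟨m - i - 1, by omega⟩
    rw [negBinomRatio, prod_range_succ, ← mul_assoc, ← negBinomRatio, ← ih (by omega)]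
    have h1 : l + i + 1 - (i + 1) = l := by omega
    have h2 : l + i + 1 - i = l + 1 := by omega
    rw [h1, h2]
    have h3 := succ_mul_negBinom hn l
    have h4 : (0 : ℝ) < n + l := by positivity
    push_cast
    have h5 : (n + (l + i + 1) - 1 - i : ℝ) = n + l := by ring
    have h6 : (l + i + 1 - i : ℝ) = l + 1 := by ring
    rw [h5, h6, mul_div_assoc', eq_div_iff h4.ne']
    linarith

/-- The hypothesis bounds the first factor by `ρ`; lowering numerator and denominator of a fraction
below `1` by the same amount only decreases it. For `i > m` the factor with numerator `m - m` makes
the product zero. -/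
lemma negBinomRatio_mem {n m : ℕ} {ρ : ℝ} (hn : 0 < n) (hρ0 : 0 ≤ ρ) (hρ1 : ρ < 1)
    (h : (m : ℝ) ≤ ρ * (n + m - 1)) (i : ℕ) :
    0 ≤ negBinomRatio n m i ∧ negBinomRatio n m i ≤ ρ ^ i := by
  have hn' : (1 : ℝ) ≤ n := by exact_mod_cast hn
  induction i with
  | zero => simp [negBinomRatio]
  | succ i ih =>
    have key : negBinomRatio n m (i + 1) =
        negBinomRatio n m i * ((m - i : ℝ) / (n + m - 1 - i)) := prod_range_succ _ _
    rcases lt_or_ge i m with him | him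
    · have him' : (i : ℝ) + 1 ≤ m := by exact_mod_cast him
      have h1 : (0 : ℝ) < n + m - 1 - i := by linarith
      have h2 : (m - i : ℝ) / (n + m - 1 - i) ≤ ρ := by
        rw [div_le_iff₀ h1]
        nlinarith [mul_nonneg (Nat.cast_nonneg i : (0 : ℝ) ≤ i) (sub_nonneg.2 hρ1.le)]
      have h3 : 0 ≤ (m - i : ℝ) / (n + m - 1 - i) := div_nonneg (by linarith) h1.le
      rw [key, pow_succ]
      exact ⟨mul_nonneg ih.1 h3, mul_le_mul ih.2 h2 h3 (by positivity)⟩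
    · rw [negBinomRatio_eq_zero n (by omega)]
      exact ⟨le_rfl, by positivity⟩

/-- The linear functional sending `X^i` to `negBinomRatio n m i`. -/
noncomputable def ratioFunctional (n m : ℕ) : ℝ[X] →ₗ[ℝ] ℝ :=
  Polynomial.lsum fun i => negBinomRatio n m i • LinearMap.id

lemma ratioFunctional_monomial (n m i : ℕ) (a : ℝ) :
    ratioFunctional n m (monomial i a) = a * negBinomRatio n m i := by
  simp [ratioFunctional, Polynomial.lsum_apply, Polynomial.sum_monomial_index, mul_comm]

lemma ratioFunctional_eq_sum (n m : ℕ) (Q : ℝ[X]) {N : ℕ} (hN : Q.natDegree < N) :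
    ratioFunctional n m Q = ∑ i ∈ range N, Q.coeff i * negBinomRatio n m i := by
  conv_lhs => rw [Q.as_sum_range' N hN, map_sum]
  exact sum_congr rfl fun i _ => ratioFunctional_monomial n m i _

/-- Write `Q = (1 - X) ^ (-n) * R` and expand: `X ^ i` in `R` contributes `negBinom n (m - i)`,
which the functional records relative to `negBinom n m`. -/
lemma coeff_eq_ratioFunctional {n : ℕ} (hn : 0 < n) (m : ℕ) (Q : ℝ[X]) :
    Q.coeff m = negBinom n m * ratioFunctional n m ((1 - X) ^ n * Q) := by
  set R := (1 - X) ^ n * Q with hR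
  have h1 : (Q : PowerSeries ℝ) = (R : PowerSeries ℝ) * (PowerSeries.invOneSubPow ℝ n).val := by
    have h2 : (PowerSeries.invOneSubPow ℝ n).val * (1 - PowerSeries.X) ^ n = 1 := by
      rw [← PowerSeries.invOneSubPow_inv_eq_one_sub_pow]
      exact Units.val_inv _
    rw [hR]
    push_cast
    linear_combination (-(Q : PowerSeries ℝ)) * h2
  rw [← Polynomial.coeff_coe, h1, PowerSeries.coeff_mul,
    PowerSeries.invOneSubPow_val_eq_mk_sub_one_add_choose_of_pos _ _ hn,
    ratioFunctional_eq_sum n m R (show R.natDegree < R.natDegree + m + 1 by omega),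
    Finset.Nat.sum_antidiagonal_eq_sum_range_succ_mk, mul_sum]
  refine sum_subset_zero_on_sdiff (range_subset_range.2 (by omega)) (fun i hi => ?_)
    (fun i hi => ?_)
  · rw [Finset.mem_sdiff, Finset.mem_range, Finset.mem_range] at hi
    rw [negBinomRatio_eq_zero n (by omega)]
    simp
  · rw [Finset.mem_range] at hi
    simp only [PowerSeries.coeff_mk, Polynomial.coeff_coe]
    have h4 := negBinom_sub hn m i (by omega)
    rw [mul_left_comm, ← h4, negBinom]

lemma abs_ratioFunctional_le {n m : ℕ} {ρ : ℝ} (hn : 0 < n) (hρ0 : 0 ≤ ρ) (hρ1 : ρ < 1)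
    (h : (m : ℝ) ≤ ρ * (n + m - 1)) {Q G : ℝ[X]} (hQ : ∀ i, |Q.coeff i| ≤ G.coeff i) :
    |ratioFunctional n m Q| ≤ G.eval ρ := by
  have hN : G.natDegree < max G.natDegree Q.natDegree + 1 := by omega
  rw [ratioFunctional_eq_sum n m Q (show Q.natDegree < max G.natDegree Q.natDegree + 1 by omega),
    eval_eq_sum_range' hN]
  refine (abs_sum_le_sum_abs _ _).trans (sum_le_sum fun i _ => ?_)
  have h1 := negBinomRatio_mem hn hρ0 hρ1 h i
  rw [abs_mul, abs_of_nonneg h1.1]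
  exact mul_le_mul (hQ i) h1.2 h1.1 ((abs_nonneg _).trans (hQ i))

/-- A series dominating `∑ (1 - X)^n T_n z^n`, where `T_n` are the coefficients of
`chordSeries`. -/
noncomputable def thetaMajorant : PowerSeries ℝ[X] :=
  PowerSeries.mk fun n => ∑ j ∈ range (n + 1), monomial ((j + 1).choose 2) (ballotNum n j)

lemma coeff_chordSeries_eq_sum_monomial {n J : ℕ} (hJ : n < J) :
    (1 - X) ^ n * PowerSeries.coeff n chordSeries =
      ∑ j ∈ range J, monomial ((j + 1).choose 2) ((-1) ^ j * ballotNum n j) := by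
  rw [coeff_chordSeries_eq hJ]
  refine sum_congr rfl fun j _ => ?_
  rw [thetaCoeff, range_zero, prod_empty, mul_one, ← C_mul_X_pow_eq_monomial, map_mul, map_pow,
    map_neg, map_one]
  ring

lemma rescale_chordSeries_majorized :
    Majorized (PowerSeries.rescale (1 - X) chordSeries) thetaMajorant := fun n i => by
  rw [PowerSeries.coeff_rescale, coeff_chordSeries_eq_sum_monomial (Nat.lt_succ_self n),
    thetaMajorant, PowerSeries.coeff_mk, finsetSum_coeff, finsetSum_coeff]
  refine (abs_sum_le_sum_abs _ _).trans (sum_le_sum fun j _ => ?_)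
  rw [coeff_monomial, coeff_monomial]
  split_ifs
  · rw [abs_mul, abs_pow, abs_neg, abs_one, one_pow, one_mul, abs_of_nonneg (ballotNum_nonneg n j)]
  · simp

lemma rescale_tailSeries {R : Type*} [CommRing R] (k : ℕ) (r : R) (a : PowerSeries R) :
    PowerSeries.rescale r (tailSeries k a) = tailSeries k (PowerSeries.rescale r a) := by
  ext1 n
  simp only [tailSeries, PowerSeries.coeff_rescale, PowerSeries.coeff_mk]
  split_ifs <;> simp

lemma map_tailSeries {R S : Type*} [CommRing R] [CommRing S] (k : ℕ) (f : R →+* S)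
    (a : PowerSeries R) : PowerSeries.map f (tailSeries k a) = tailSeries k (PowerSeries.map f a) := by
  ext1 n
  simp only [tailSeries, PowerSeries.coeff_map, PowerSeries.coeff_mk]
  split_ifs <;> simp

/-- The bound `∑ (2j+1) ρ^(j+1 choose 2)` for theta series. -/
noncomputable def thetaBound (ρ : ℝ) : ℝ := ∑' j : ℕ, (2 * j + 1) * ρ ^ (j + 1).choose 2

lemma coeff_map_thetaMajorant_mem {ρ : ℝ} (hρ0 : 0 ≤ ρ) (hρ1 : ρ < 1) (n : ℕ) :
    0 ≤ PowerSeries.coeff n (PowerSeries.map (evalRingHom ρ) thetaMajorant) ∧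
    PowerSeries.coeff n (PowerSeries.map (evalRingHom ρ) thetaMajorant) ≤
      thetaBound ρ * ballotNum n 0 := by
  have h0 : PowerSeries.coeff n (PowerSeries.map (evalRingHom ρ) thetaMajorant) =
      ∑ j ∈ range (n + 1), ballotNum n j * ρ ^ (j + 1).choose 2 := by
    simp [thetaMajorant]
  rw [h0]
  refine ⟨sum_nonneg fun j _ => mul_nonneg (ballotNum_nonneg n j) (by positivity), ?_⟩
  rw [thetaBound, ← tsum_mul_right]
  have h1 := (summable_odd_mul_pow_choose hρ0 hρ1).mul_right (ballotNum n 0)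
  refine (sum_le_sum fun j _ => ?_).trans (h1.sum_le_tsum (range (n + 1)) fun j _ =>
    mul_nonneg (by positivity) (ballotNum_nonneg n 0))
  calc ballotNum n j * ρ ^ (j + 1).choose 2
      ≤ (2 * j + 1) * ballotNum n 0 * ρ ^ (j + 1).choose 2 := by gcongr; exact ballotNum_le n j
    _ = _ := by ring

section numeric

variable {a b : PowerSeries ℝ} {α β : ℝ}

lemma ballotNum_zero_eq (n : ℕ) : ballotNum n 0 = 4 ^ n * scaledCatalan n := by
  rw [scaledCatalan]
  field_simp

lemma coeff_mul_mem
    (ha : ∀ n, 0 ≤ PowerSeries.coeff n a ∧ PowerSeries.coeff n a ≤ α * ballotNum n 0)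
    (hb : ∀ n, 0 ≤ PowerSeries.coeff n b ∧ PowerSeries.coeff n b ≤ β * ballotNum n 0) (n : ℕ) :
    0 ≤ PowerSeries.coeff n (a * b) ∧
      PowerSeries.coeff n (a * b) ≤ α * (4 * β) * ballotNum n 0 := by
  have hα : 0 ≤ α := by
    have := (ha 0).1.trans (ha 0).2
    exact nonneg_of_mul_nonneg_left this (ballotNum_zero_right_pos 0)
  have hβ : 0 ≤ β := by
    have := (hb 0).1.trans (hb 0).2
    exact nonneg_of_mul_nonneg_left this (ballotNum_zero_right_pos 0)
  rw [PowerSeries.coeff_mul]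
  refine ⟨sum_nonneg fun p _ => mul_nonneg (ha _).1 (hb _).1, ?_⟩
  calc ∑ p ∈ antidiagonal n, PowerSeries.coeff p.1 a * PowerSeries.coeff p.2 b
      ≤ ∑ p ∈ antidiagonal n, α * β * 4 ^ n * (scaledCatalan p.1 * scaledCatalan p.2) := by
        refine sum_le_sum fun p hp => ?_
        refine (mul_le_mul (ha _).2 (hb _).2 (hb _).1
          (mul_nonneg hα (ballotNum_nonneg _ _))).trans (le_of_eq ?_)
        rw [← mem_antidiagonal.1 hp, ballotNum_zero_eq, ballotNum_zero_eq, pow_add]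
        ring
    _ = α * β * 4 ^ n * ∑ p ∈ antidiagonal n, scaledCatalan p.1 * scaledCatalan p.2 := by
        rw [mul_sum]
    _ ≤ α * β * 4 ^ n * (4 * scaledCatalan n) :=
        mul_le_mul_of_nonneg_left (sum_scaledCatalan_mul n) (by positivity)
    _ = _ := by
        rw [ballotNum_zero_eq]
        ring

lemma coeff_mul_pow_mem
    (ha : ∀ n, 0 ≤ PowerSeries.coeff n a ∧ PowerSeries.coeff n a ≤ α * ballotNum n 0)
    (hb : ∀ n, 0 ≤ PowerSeries.coeff n b ∧ PowerSeries.coeff n b ≤ β * ballotNum n 0) (r : ℕ) :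
    ∀ n, 0 ≤ PowerSeries.coeff n (a * b ^ r) ∧
      PowerSeries.coeff n (a * b ^ r) ≤ α * (4 * β) ^ r * ballotNum n 0 := by
  induction r with
  | zero => simpa using ha
  | succ r ih =>
    intro n
    have := coeff_mul_mem ih hb n
    rw [pow_succ, ← mul_assoc, pow_succ, ← mul_assoc]
    exact this

/-- The tail sums of the scaled Catalan numbers. -/
noncomputable def catalanTail (k : ℕ) : ℝ := ∑' i : ℕ, if i < k then 0 else scaledCatalan i

lemma abs_ite_scaledCatalan_le (k i : ℕ) :
    ‖if i < k then 0 else scaledCatalan i‖ ≤ scaledCatalan i := by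
  have := scaledCatalan_pos i
  split_ifs
  · simpa using this.le
  · rw [Real.norm_eq_abs, abs_of_pos this]

lemma tendsto_catalanTail : Tendsto catalanTail atTop (𝓝 0) := by
  have : Tendsto catalanTail atTop (𝓝 (∑' _ : ℕ, (0 : ℝ))) := by
    refine tendsto_tsum_of_dominated_convergence summable_scaledCatalan (fun i => ?_)
      (Eventually.of_forall fun k i => abs_ite_scaledCatalan_le k i)
    refine tendsto_const_nhds.congr' ?_
    filter_upwards [eventually_gt_atTop i] with k hk
    rw [if_pos hk]
  simpa using this

lemma sum_ite_scaledCatalan_le (k n : ℕ) :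
    ∑ i ∈ range n, (if i < k then 0 else scaledCatalan i) ≤ catalanTail k := by
  refine (Summable.of_norm_bounded summable_scaledCatalan
    (abs_ite_scaledCatalan_le k)).sum_le_tsum _ fun i _ => ?_
  have := scaledCatalan_pos i
  split_ifs <;> linarith

/-- Of two indices with sum `n` the larger is at least about `n / 2`, so its scaled Catalan number
is at most `4 * scaledCatalan n`; summing the other one gives a Catalan tail. -/
lemma coeff_tailSeries_sq_mem
    (ha : ∀ n, 0 ≤ PowerSeries.coeff n a ∧ PowerSeries.coeff n a ≤ α * ballotNum n 0) (k n : ℕ) :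
    0 ≤ PowerSeries.coeff n (tailSeries k a ^ 2) ∧
      PowerSeries.coeff n (tailSeries k a ^ 2) ≤ 8 * α ^ 2 * catalanTail k * ballotNum n 0 := by
  have hα : 0 ≤ α := by
    have := (ha 0).1.trans (ha 0).2
    exact nonneg_of_mul_nonneg_left this (ballotNum_zero_right_pos 0)
  have ht : ∀ i, 0 ≤ PowerSeries.coeff i (tailSeries k a) ∧
      PowerSeries.coeff i (tailSeries k a) ≤
        α * 4 ^ i * (if i < k then 0 else scaledCatalan i) := by
    intro i
    rw [tailSeries, PowerSeries.coeff_mk]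
    split_ifs
    · simp
    · refine ⟨(ha i).1, (ha i).2.trans (le_of_eq ?_)⟩
      rw [ballotNum_zero_eq, mul_assoc]
  have hs : ∀ i, 0 ≤ (if i < k then 0 else scaledCatalan i) := by
    intro i
    have := scaledCatalan_pos i
    split_ifs <;> linarith
  have hterm : ∀ p ∈ antidiagonal n, (if p.1 < k then 0 else scaledCatalan p.1) *
      (if p.2 < k then 0 else scaledCatalan p.2) ≤
      4 * scaledCatalan n * ((if p.1 < k then 0 else scaledCatalan p.1) +
        (if p.2 < k then 0 else scaledCatalan p.2)) := by
    intro p hp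
    rw [HasAntidiagonal.mem_antidiagonal] at hp
    have h1 := hs p.1
    have h2 := hs p.2
    have h3 : ∀ i, (if i < k then 0 else scaledCatalan i) ≤ scaledCatalan i :=
      fun i => (le_abs_self _).trans (abs_ite_scaledCatalan_le k i)
    have h4 := scaledCatalan_pos n
    rcases le_total p.1 p.2 with h | h
    · have h5 := (h3 p.2).trans (scaledCatalan_le_four_mul (n := n) (by omega) (by omega))
      nlinarith
    · have h5 := (h3 p.1).trans (scaledCatalan_le_four_mul (n := n) (by omega) (by omega))
      nlinarith
  rw [pow_two, PowerSeries.coeff_mul]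
  refine ⟨sum_nonneg fun p _ => mul_nonneg (ht _).1 (ht _).1, ?_⟩
  have hsum1 : ∑ p ∈ antidiagonal n, (if p.1 < k then 0 else scaledCatalan p.1) ≤ catalanTail k := by
    rw [Finset.Nat.sum_antidiagonal_eq_sum_range_succ_mk]
    exact sum_ite_scaledCatalan_le k _
  have hsum2 : ∑ p ∈ antidiagonal n, (if p.2 < k then 0 else scaledCatalan p.2) ≤ catalanTail k := by
    rw [← Finset.Nat.sum_antidiagonal_swap]
    exact hsum1
  calc ∑ p ∈ antidiagonal n, PowerSeries.coeff p.1 (tailSeries k a) *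
        PowerSeries.coeff p.2 (tailSeries k a)
      ≤ ∑ p ∈ antidiagonal n, α ^ 2 * 4 ^ n * (4 * scaledCatalan n *
        ((if p.1 < k then 0 else scaledCatalan p.1) +
          (if p.2 < k then 0 else scaledCatalan p.2))) := by
        refine sum_le_sum fun p hp => ?_
        refine (mul_le_mul (ht _).2 (ht _).2 (ht _).1
          (mul_nonneg (by positivity) (hs _))).trans ?_
        have h1 := mul_le_mul_of_nonneg_left (hterm p hp)
          (show (0 : ℝ) ≤ α ^ 2 * 4 ^ n by positivity)
        refine le_trans (le_of_eq ?_) h1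
        rw [← mem_antidiagonal.1 hp, pow_add]
        ring
    _ = α ^ 2 * 4 ^ n * (4 * scaledCatalan n) *
        (∑ p ∈ antidiagonal n, (if p.1 < k then 0 else scaledCatalan p.1) +
          ∑ p ∈ antidiagonal n, (if p.2 < k then 0 else scaledCatalan p.2)) := by
        rw [← sum_add_distrib, mul_sum]
        exact sum_congr rfl fun p _ => by ring
    _ ≤ α ^ 2 * 4 ^ n * (4 * scaledCatalan n) * (catalanTail k + catalanTail k) := by
        have := (scaledCatalan_pos n).le
        exact mul_le_mul_of_nonneg_left (add_le_add hsum1 hsum2) (by positivity)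
    _ = _ := by
        rw [ballotNum_zero_eq]
        ring

end numeric

/-- Domination moves the problem to products of `chordSeries` and its tail. Rescaling `z` by `1 - X`
puts these in the form required by the functional, and `thetaMajorant` then reduces everything to
Catalan convolutions at `x = ρ`. -/
lemma abs_coeff_le_of_majorized {ρ : ℝ} (hρ0 : 0 ≤ ρ) (hρ1 : ρ < 1) {c k r : ℕ}
    {R : PowerSeries ℝ[X]}
    (hR : Majorized R (c * (tailSeries k chordSeries ^ 2 * chordSeries ^ r))) {n m : ℕ}
    (hn : 0 < n) (h : (m : ℝ) ≤ ρ * (n + m - 1)) :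
    |(PowerSeries.coeff n R).coeff m| ≤
      c * (8 * thetaBound ρ ^ 2 * (4 * thetaBound ρ) ^ r) * catalanTail k *
        (negBinom n m * ballotNum n 0) := by
  set S := tailSeries k chordSeries ^ 2 * chordSeries ^ r with hS
  have h1 := hR n m
  rw [← nsmul_eq_mul, map_nsmul, coeff_smul, nsmul_eq_mul] at h1
  have h2 : Majorized (PowerSeries.rescale (1 - X) S)
      (tailSeries k thetaMajorant ^ 2 * thetaMajorant ^ r) := by
    rw [hS, map_mul, map_pow, map_pow, rescale_tailSeries]
    exact ((rescale_chordSeries_majorized.tailSeries k).pow 2).mul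
      (rescale_chordSeries_majorized.pow r)
  have h3 := abs_ratioFunctional_le hn hρ0 hρ1 h (h2 n)
  rw [PowerSeries.coeff_rescale] at h3
  have h4 : (PowerSeries.coeff n (tailSeries k thetaMajorant ^ 2 * thetaMajorant ^ r)).eval ρ =
      PowerSeries.coeff n (tailSeries k (PowerSeries.map (evalRingHom ρ) thetaMajorant) ^ 2 *
        PowerSeries.map (evalRingHom ρ) thetaMajorant ^ r) := by
    rw [← map_tailSeries, ← map_pow, ← map_pow, ← map_mul, PowerSeries.coeff_map, coe_evalRingHom]
  have h5 := (coeff_mul_pow_mem (coeff_tailSeries_sq_mem (coeff_map_thetaMajorant_mem hρ0 hρ1) k)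
    (coeff_map_thetaMajorant_mem hρ0 hρ1) r n).2
  rw [h4] at h3
  rw [coeff_eq_ratioFunctional hn m (PowerSeries.coeff n S)] at h1
  have h6 := (le_abs_self _).trans (h3.trans h5)
  have h7 := negBinom_pos n m
  calc |(PowerSeries.coeff n R).coeff m|
      ≤ _ := h1
    _ ≤ c * (negBinom n m * (8 * thetaBound ρ ^ 2 * catalanTail k * (4 * thetaBound ρ) ^ r *
          ballotNum n 0)) := by gcongr
    _ = _ := by ring

end ChordCount

namespace ChordCount

/-! ### Limits along sequences with convergent crossing ratio. -/

open Finset Polynomial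

section sequences

variable {n m : ℕ → ℕ} {q : ℝ}

lemma tendsto_add_atTop_of_left (hn : Tendsto n atTop atTop) :
    Tendsto (fun k => (m k : ℝ) + n k) atTop atTop :=
  tendsto_atTop_mono (fun k => le_add_of_nonneg_left (Nat.cast_nonneg (m k)))
    (tendsto_natCast_atTop_atTop.comp hn)

lemma tendsto_negBinomRatio (hn : Tendsto n atTop atTop)
    (hq : Tendsto (fun k => crossingRatio (n k) (m k)) atTop (𝓝 q)) (i : ℕ) :
    Tendsto (fun k => negBinomRatio (n k) (m k) i) atTop (𝓝 (q ^ i)) := by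
  have h1 : q ^ i = ∏ _t ∈ range i, q := by simp
  rw [h1]
  refine tendsto_finsetProd _ fun t _ => ?_
  have hN := tendsto_add_atTop_of_left (m := m) hn
  have h2 : Tendsto (fun k => (crossingRatio (n k) (m k) - t / ((m k : ℝ) + n k)) /
      (1 - (1 + t) / ((m k : ℝ) + n k))) atTop (𝓝 ((q - 0) / (1 - 0))) :=
    (hq.sub (tendsto_const_nhds.div_atTop hN)).div
      (tendsto_const_nhds.sub (tendsto_const_nhds.div_atTop hN)) (by norm_num)
  rw [sub_zero, sub_zero, div_one] at h2
  refine h2.congr' ?_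
  filter_upwards [hN.eventually_gt_atTop 0] with k hk
  have h3 : (n k + m k - 1 - t : ℝ) = (m k + n k) * (1 - (1 + t) / ((m k : ℝ) + n k)) := by
    field_simp
    ring
  have h4 : (m k - t : ℝ) =
      (m k + n k) * (crossingRatio (n k) (m k) - t / ((m k : ℝ) + n k)) := by
    rw [crossingRatio]
    field_simp
  rw [h3, h4, mul_div_mul_left _ _ hk.ne']

lemma eventually_le_mul (hn : Tendsto n atTop atTop)
    (hq : Tendsto (fun k => crossingRatio (n k) (m k)) atTop (𝓝 q)) {ρ : ℝ} (hρ : q < ρ) :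
    ∀ᶠ k in atTop, 0 < n k ∧ (m k : ℝ) ≤ ρ * (n k + m k - 1) := by
  -- The gap `ρ - σ` absorbs the `-1` once `(ρ - σ) (m + n) ≥ ρ`.
  obtain ⟨σ, hσ1, hσ2⟩ := exists_between hρ
  have hN := tendsto_add_atTop_of_left (m := m) hn
  filter_upwards [hN.eventually_gt_atTop 0, hN.eventually_ge_atTop (ρ / (ρ - σ)),
    hn.eventually_gt_atTop 0, hq.eventually (gt_mem_nhds hσ1)] with k h1 h2 h3 h4
  refine ⟨h3, ?_⟩
  rw [crossingRatio, div_lt_iff₀ h1] at h4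
  rw [div_le_iff₀ (by linarith)] at h2
  nlinarith

lemma ballotNum_zero_monotone : Monotone fun n => ballotNum n 0 :=
  monotone_nat_of_le_succ fun n => by
    rw [ballotNum_succ_zero]
    linarith [ballotNum_nonneg n 1]

lemma tendsto_ratioFunctional (hn : Tendsto n atTop atTop)
    (hq : Tendsto (fun k => crossingRatio (n k) (m k)) atTop (𝓝 q)) (hq0 : 0 ≤ q) (hq1 : q < 1)
    (s : ℕ) (Q : ℝ[X]) :
    Tendsto (fun k => ratioFunctional (n k) (m k)
      (Q * ((1 - X) ^ (n k - s) * PowerSeries.coeff (n k - s) chordSeries)) / ballotNum (n k) 0)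
      atTop (𝓝 (Q.eval q * (1 / 4) ^ s * oddTheta q)) := by
  induction Q using Polynomial.induction_on' with
  | add Q R hQ hR =>
    have := hQ.add hR
    rw [← add_mul, ← add_mul, ← eval_add] at this
    refine this.congr fun k => ?_
    rw [add_mul, map_add, add_div]
  | monomial t a =>
    obtain ⟨ρ, hρ1, hρ2⟩ := exists_between hq1
    have hρ0 : 0 ≤ ρ := hq0.trans hρ1.le
    have h1 : ∀ k, ratioFunctional (n k) (m k) ((monomial t a) *
        ((1 - X) ^ (n k - s) * PowerSeries.coeff (n k - s) chordSeries)) / ballotNum (n k) 0 =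
        ∑' j : ℕ, a * (-1) ^ j * (ballotNum (n k - s) j / ballotNum (n k) 0) *
          negBinomRatio (n k) (m k) (t + (j + 1).choose 2) := by
      intro k
      rw [coeff_chordSeries_eq_sum_monomial (Nat.lt_succ_self (n k - s)), mul_sum, map_sum, sum_div,
        tsum_eq_sum (s := range (n k - s).succ)]
      · refine sum_congr rfl fun j _ => ?_
        rw [monomial_mul_monomial, ratioFunctional_monomial]
        ring
      · intro j hj
        rw [Finset.mem_range, not_lt] at hj
        rw [ballotNum_eq_zero (by omega)]
        simp
    simp only [h1]
    have h2 : (monomial t a).eval q * (1 / 4) ^ s * oddTheta q =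
        ∑' j : ℕ, a * (-1) ^ j * ((2 * j + 1) * (1 / 4) ^ s) * q ^ (t + (j + 1).choose 2) := by
      rw [oddTheta, ← tsum_mul_left, eval_monomial]
      refine tsum_congr fun j => ?_
      rw [pow_add]
      ring
    rw [h2]
    refine tendsto_tsum_of_dominated_convergence
      ((summable_odd_mul_pow_choose hρ0 hρ2).mul_left |a|) (fun j => ?_) ?_
    · exact (((tendsto_ballotNum_sub_div s j).comp hn).const_mul _).mul
        (tendsto_negBinomRatio hn hq _)
    · filter_upwards [eventually_le_mul hn hq hρ1] with k hk j
      have h3 := negBinomRatio_mem hk.1 hρ0 hρ2 hk.2 (t + (j + 1).choose 2)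
      have h4 : negBinomRatio (n k) (m k) (t + (j + 1).choose 2) ≤ ρ ^ (j + 1).choose 2 :=
        h3.2.trans (pow_le_pow_of_le_one hρ0 hρ2.le (by omega))
      have h5 : ballotNum (n k - s) j / ballotNum (n k) 0 ≤ 2 * j + 1 := by
        rw [div_le_iff₀ (ballotNum_zero_right_pos _)]
        refine (ballotNum_le _ _).trans (mul_le_mul_of_nonneg_left ?_ (by positivity))
        exact ballotNum_zero_monotone (Nat.sub_le _ _)
      have h6 : 0 ≤ ballotNum (n k - s) j / ballotNum (n k) 0 :=
        div_nonneg (ballotNum_nonneg _ _) (ballotNum_nonneg _ _)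
      rw [Real.norm_eq_abs, abs_mul, abs_mul, abs_mul, abs_pow, abs_neg, abs_one, one_pow, mul_one,
        abs_of_nonneg h6, abs_of_nonneg h3.1, mul_assoc]
      gcongr
      exact h3.1

/-- Multiplying by `z ^ s` lowers the chord index by `s`: the normalization leaves a factor `(1 - X)
^ s` and the Catalan ratios a factor `4 ^ (-s)`. Hence `z` is evaluated at `(1 - q) / 4`. -/
lemma tendsto_coeff_mul_chordSeries (hn : Tendsto n atTop atTop)
    (hq : Tendsto (fun k => crossingRatio (n k) (m k)) atTop (𝓝 q)) (hq0 : 0 ≤ q) (hq1 : q < 1)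
    (c : ℝ[X][X]) :
    Tendsto (fun k => (PowerSeries.coeff (n k) ((c : PowerSeries ℝ[X]) * chordSeries)).coeff (m k) /
      (negBinom (n k) (m k) * ballotNum (n k) 0)) atTop
      (𝓝 (c.eval₂ (evalRingHom q) ((1 - q) / 4) * oddTheta q)) := by
  induction c using Polynomial.induction_on' with
  | add a b ha hb =>
    have := ha.add hb
    rw [← add_mul, ← eval₂_add] at this
    refine this.congr fun k => ?_
    rw [Polynomial.coe_add, add_mul, map_add, coeff_add, add_div]
  | monomial s a =>
    have h1 := tendsto_ratioFunctional hn hq hq0 hq1 s ((1 - X) ^ s * a)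
    have h2 : ((1 - X) ^ s * a).eval q * (1 / 4) ^ s * oddTheta q =
        (monomial s a).eval₂ (evalRingHom q) ((1 - q) / 4) * oddTheta q := by
      rw [eval₂_monomial, div_pow, div_pow, one_pow, eval_mul, eval_pow, coe_evalRingHom, eval_sub,
        eval_one, eval_X]
      ring
    rw [h2] at h1
    refine h1.congr' ?_
    filter_upwards [hn.eventually_gt_atTop 0, hn.eventually_ge_atTop s] with k hk1 hk2
    have h3 : PowerSeries.coeff (n k) (((monomial s a : ℝ[X][X]) : PowerSeries ℝ[X]) *
        chordSeries) = a * PowerSeries.coeff (n k - s) chordSeries := by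
      rw [← C_mul_X_pow_eq_monomial, Polynomial.coe_mul, Polynomial.coe_C, Polynomial.coe_pow,
        Polynomial.coe_X, mul_assoc, PowerSeries.coeff_C_mul,
        PowerSeries.coeff_X_pow_mul', if_pos hk2]
    have h4 : (1 - X : ℝ[X]) ^ n k = (1 - X) ^ (n k - s) * (1 - X) ^ s := by
      rw [← pow_add, Nat.sub_add_cancel hk2]
    rw [h3, coeff_eq_ratioFunctional hk1, mul_div_mul_left _ _ (negBinom_pos _ _).ne', h4]
    congr 2
    ring

end sequences

lemma tendsto_of_forall_approx {x : ℕ → ℝ} {y : ℕ → ℕ → ℝ} {Y δ : ℕ → ℝ} {L : ℝ}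
    (h : ∀ k, ∀ᶠ i in atTop, |x i - y k i| ≤ δ k) (hy : ∀ k, Tendsto (y k) atTop (𝓝 (Y k)))
    (hY : Tendsto Y atTop (𝓝 L)) (hδ : Tendsto δ atTop (𝓝 0)) : Tendsto x atTop (𝓝 L) := by
  rw [Metric.tendsto_nhds]
  intro ε hε
  obtain ⟨k, hk1, hk2⟩ := ((hδ.eventually (gt_mem_nhds (show 0 < ε / 3 by positivity))).and
    (Metric.tendsto_nhds.1 hY (ε / 3) (by positivity))).exists
  filter_upwards [h k, Metric.tendsto_nhds.1 (hy k) (ε / 3) (by positivity)] with i h1 h2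
  rw [Real.dist_eq] at *
  have h3 : x i - L = (x i - y k i) + (y k i - Y k) + (Y k - L) := by ring
  rw [h3]
  refine (abs_add_three _ _ _).trans_lt ?_
  linarith

/-! ### Evaluation at `z = (1 - x) / 4`, and the limit law. -/

section evaluation

variable {x : ℝ} (hx0 : 0 ≤ x) (hx1 : x < 1)

/-- The value at `x` of the `n`-th coefficient of a series, scaled by `((1 - x) / 4)^n`. -/
noncomputable def scaledEval (x : ℝ) (a : PowerSeries ℝ[X]) (n : ℕ) : ℝ :=
  (PowerSeries.coeff n a).eval x * ((1 - x) / 4) ^ n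

lemma scaledEval_chordSeries (n : ℕ) : scaledEval x chordSeries n =
    ∑' j : ℕ, (-1) ^ j * x ^ (j + 1).choose 2 * (ballotNum n j / 4 ^ n) := by
  have h1 := congrArg (Polynomial.eval x)
    (coeff_chordSeries_eq_sum_monomial (Nat.lt_succ_self n))
  rw [eval_mul, eval_finsetSum] at h1
  simp only [eval_pow, eval_sub, eval_one, eval_X, eval_monomial] at h1
  rw [tsum_eq_sum (s := range n.succ), scaledEval, div_pow, mul_div_assoc', mul_comm, h1, sum_div]
  · exact sum_congr rfl fun j _ => by ring
  · intro j hj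
    rw [Finset.mem_range, not_lt] at hj
    rw [ballotNum_eq_zero (by omega)]
    simp

lemma eval_le_eval_of_abs_coeff_le {Q G : ℝ[X]} (hx0 : 0 ≤ x)
    (h : ∀ i, |Q.coeff i| ≤ G.coeff i) : |Q.eval x| ≤ G.eval x := by
  rw [eval_eq_sum_range' (show Q.natDegree < max Q.natDegree G.natDegree + 1 by omega),
    eval_eq_sum_range' (show G.natDegree < max Q.natDegree G.natDegree + 1 by omega)]
  refine (abs_sum_le_sum_abs _ _).trans (sum_le_sum fun i _ => ?_)
  rw [abs_mul, abs_of_nonneg (pow_nonneg hx0 i)]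
  exact mul_le_mul_of_nonneg_right (h i) (pow_nonneg hx0 i)

include hx0 hx1

lemma abs_scaledEval_le {a b : PowerSeries ℝ[X]} (h : Majorized a b) (n : ℕ) :
    |scaledEval x a n| ≤ scaledEval x b n := by
  have h1 : 0 ≤ ((1 - x) / 4) ^ n := pow_nonneg (by linarith) n
  rw [scaledEval, scaledEval, abs_mul, abs_of_nonneg h1]
  exact mul_le_mul_of_nonneg_right (eval_le_eval_of_abs_coeff_le hx0 (h n)) h1

/-- Insert the Touchard–Riordan formula and exchange the sums: each ballot column contributes `2`.
Absolute summability holds because `ballotNum n j ≤ (2 j + 1) * ballotNum n 0`. -/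
lemma hasSum_scaledEval_chordSeries : HasSum (scaledEval x chordSeries) (2 * altTheta x) := by
  have h1 : Summable fun p : ℕ × ℕ =>
      (-1) ^ p.2 * x ^ (p.2 + 1).choose 2 * (ballotNum p.1 p.2 / 4 ^ p.1) := by
    refine Summable.of_norm_bounded (summable_scaledCatalan.mul_of_nonneg
      (summable_odd_mul_pow_choose hx0 hx1) (fun n => (scaledCatalan_pos n).le)
      (fun j => by positivity)) fun p => ?_
    rw [Real.norm_eq_abs, abs_mul, abs_mul, abs_pow, abs_neg, abs_one, one_pow, one_mul,
      abs_of_nonneg (pow_nonneg hx0 _),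
      abs_of_nonneg (div_nonneg (ballotNum_nonneg _ _) (by positivity))]
    have h2 : ballotNum p.1 p.2 / 4 ^ p.1 ≤ (2 * p.2 + 1) * scaledCatalan p.1 := by
      rw [scaledCatalan, mul_div_assoc']
      gcongr
      exact ballotNum_le _ _
    calc x ^ (p.2 + 1).choose 2 * (ballotNum p.1 p.2 / 4 ^ p.1)
        ≤ x ^ (p.2 + 1).choose 2 * ((2 * p.2 + 1) * scaledCatalan p.1) := by gcongr
      _ = _ := by ring
  have h2 : Summable (scaledEval x chordSeries) := by
    refine h1.prod.congr fun n => ?_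
    rw [scaledEval_chordSeries]
  have h3 : ∑' n, scaledEval x chordSeries n = 2 * altTheta x := by
    simp only [scaledEval_chordSeries]
    rw [← Summable.tsum_comm (f := fun n j : ℕ =>
      (-1) ^ j * x ^ (j + 1).choose 2 * (ballotNum n j / 4 ^ n)) h1]
    simp only [tsum_mul_left, tsum_ballotNum]
    rw [tsum_mul_right, altTheta, mul_comm]
  rw [← h3]
  exact h2.hasSum

/-- All terms of the series for `2 * altTheta x` are nonnegative, and the left side is the
contribution of diagrams with zero and one chord. -/
lemma one_add_le_two_mul_altTheta : 1 + (1 - x) / 4 ≤ 2 * altTheta x := by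
  have h0 : ∀ n, 0 ≤ scaledEval x chordSeries n := fun n =>
    (abs_nonneg _).trans (abs_scaledEval_le hx0 hx1 majorized_chordSeries n)
  have h1 := sum_le_hasSum (range 2) (fun n _ => h0 n) (hasSum_scaledEval_chordSeries hx0 hx1)
  refine le_trans (le_of_eq ?_) h1
  have h2 : ∀ N, scaledEval x chordSeries N = ∑ j ∈ range (N + 1),
      (-1) ^ j * x ^ (j + 1).choose 2 * (ballotNum N j / 4 ^ N) := by
    intro N
    rw [scaledEval_chordSeries, tsum_eq_sum]
    intro j hj
    rw [Finset.mem_range, not_lt] at hj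
    rw [ballotNum_eq_zero (by omega)]
    simp
  simp only [h2, sum_range_succ, range_zero, sum_empty]
  simp [ballotNum, ballot]
  ring

lemma half_lt_altTheta : 1 / 2 < altTheta x := by
  have := one_add_le_two_mul_altTheta hx0 hx1
  linarith

/-- Evaluate `invSeries * chordSeries = 1` as a Cauchy product of absolutely convergent series. -/
lemma tendsto_sum_scaledEval_invSeries :
    Tendsto (fun k => ∑ s ∈ range k, scaledEval x invSeries s) atTop
      (𝓝 (2 * altTheta x)⁻¹) := by
  have h0 : ∀ n, |scaledEval x invSeries n| ≤ scaledEval x chordSeries n :=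
    abs_scaledEval_le hx0 hx1 invSeries_majorized_chordSeries
  have hF := hasSum_scaledEval_chordSeries hx0 hx1
  have hF' : Summable fun n => ‖scaledEval x chordSeries n‖ :=
    hF.summable.congr fun n => by
      rw [Real.norm_eq_abs, abs_of_nonneg ((abs_nonneg _).trans (h0 n))]
  have hE' : Summable fun n => ‖scaledEval x invSeries n‖ :=
    Summable.of_nonneg_of_le (fun _ => norm_nonneg _) h0 hF.summable
  have h1 := tsum_mul_tsum_eq_tsum_sum_antidiagonal_of_summable_norm hE' hF'
  have h2 : ∀ n, ∑ p ∈ antidiagonal n, scaledEval x invSeries p.1 * scaledEval x chordSeries p.2 =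
      if n = 0 then 1 else 0 := by
    intro n
    have h3 : scaledEval x (invSeries * chordSeries) n = if n = 0 then 1 else 0 := by
      rw [invSeries_mul_chordSeries, scaledEval, PowerSeries.coeff_one]
      split_ifs with h
      · simp [h]
      · simp
    rw [← h3, scaledEval, PowerSeries.coeff_mul, eval_finsetSum, sum_mul]
    refine sum_congr rfl fun p hp => ?_
    rw [← HasAntidiagonal.mem_antidiagonal.1 hp, scaledEval, scaledEval, eval_mul, pow_add]
    ring
  simp only [h2] at h1
  rw [tsum_ite_eq, hF.tsum_eq] at h1
  rw [← eq_inv_of_mul_eq_one_left h1]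
  exact hE'.of_norm.hasSum.tendsto_sum_nat

end evaluation

/-- Along a sequence with `m / (m + n) → q < 1`, the number of cuts converges in distribution to a
sum of two independent geometric variables. -/
lemma tendsto_probCuts {n m : ℕ → ℕ} {q : ℝ} (hn : Tendsto n atTop atTop)
    (hq : Tendsto (fun k => crossingRatio (n k) (m k)) atTop (𝓝 q)) (hq0 : 0 ≤ q) (hq1 : q < 1)
    (j : ℕ) : Tendsto (fun k => probCuts (n k) (m k) j) atTop
      (𝓝 (((j : ℝ) + 1) * (1 - cutParam q) ^ 2 * cutParam q ^ j)) := by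
  obtain ⟨ρ, hρ1, hρ2⟩ := exists_between hq1
  have hρ0 : 0 ≤ ρ := hq0.trans hρ1.le
  obtain ⟨c, hc⟩ := exists_uncutSeries_pow_eq j
  choose P R hPR hR using hc
  set e : ℕ → ℝ[X][X] := fun k => (j + 1) * (1 - PowerSeries.trunc k invSeries) ^ j *
    PowerSeries.trunc k invSeries ^ 2 with he
  have hg := oddTheta_pos hq0 hq1
  have h1 : Tendsto (fun k => (PowerSeries.coeff (n k) (uncutSeries ^ (j + 1))).coeff (m k) /
      (negBinom (n k) (m k) * ballotNum (n k) 0)) atTop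
      (𝓝 (((j : ℝ) + 1) * (1 - cutParam q) ^ 2 * cutParam q ^ j * oddTheta q)) := by
    refine tendsto_of_forall_approx (y := fun K k => (PowerSeries.coeff (n k)
      ((e K : PowerSeries ℝ[X]) * chordSeries)).coeff (m k) /
      (negBinom (n k) (m k) * ballotNum (n k) 0))
      (Y := fun K => (e K).eval₂ (evalRingHom q) ((1 - q) / 4) * oddTheta q)
      (δ := fun K => c * (8 * thetaBound ρ ^ 2 * (4 * thetaBound ρ) ^ (j + 1)) * catalanTail K)
      (fun K => ?_) (fun K => tendsto_coeff_mul_chordSeries hn hq hq0 hq1 (e K)) ?_ ?_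
    -- Once `n` exceeds the degree of `P K` in `z`, the polynomial part contributes nothing.
    · filter_upwards [eventually_le_mul hn hq hρ1,
        hn.eventually_gt_atTop (P K).natDegree] with k hk1 hk2
      have h2 := abs_coeff_le_of_majorized hρ0 hρ2 (hR K) hk1.1 hk1.2
      have h3 : 0 < negBinom (n k) (m k) * ballotNum (n k) 0 :=
        mul_pos (negBinom_pos _ _) (ballotNum_zero_right_pos _)
      rw [hPR K, ← sub_div, abs_div, abs_of_pos h3, div_le_iff₀ h3]
      refine le_trans (le_of_eq ?_) h2
      congr 1
      rw [map_add, map_add, Polynomial.coeff_coe, coeff_eq_zero_of_natDegree_lt hk2,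
        zero_add, coeff_add]
      exact add_sub_cancel_left _ _
    · refine Tendsto.mul_const _ ?_
      have h4 : ∀ K, (e K).eval₂ (evalRingHom q) ((1 - q) / 4) =
          (j + 1) * (1 - ∑ s ∈ range K, scaledEval q invSeries s) ^ j *
            (∑ s ∈ range K, scaledEval q invSeries s) ^ 2 := by
        intro K
        have h5 : (PowerSeries.trunc K invSeries).eval₂ (evalRingHom q) ((1 - q) / 4) =
            ∑ s ∈ range K, scaledEval q invSeries s := by
          rw [PowerSeries.eval₂_trunc_eq_sum_range]
          rfl
        rw [he, ← h5]
        simp [eval₂_mul, eval₂_pow]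
      simp only [h4]
      have h6 := tendsto_sum_scaledEval_invSeries hq0 hq1
      have h7 := (((h6.const_sub 1).pow j).const_mul ((j : ℝ) + 1)).mul (h6.pow 2)
      have h8 : 1 - cutParam q = (2 * altTheta q)⁻¹ := by rw [cutParam]; ring
      rw [h8, cutParam]
      convert h7 using 2
      ring
    · simpa using tendsto_catalanTail.const_mul _
  -- The multiplier `1` gives the denominator; the common factor `oddTheta q` cancels.
  have h2 := tendsto_coeff_mul_chordSeries hn hq hq0 hq1 1
  rw [eval₂_one, one_mul] at h2
  have h3 := h1.div h2 hg.ne'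
  rw [mul_div_assoc, div_self hg.ne', mul_one] at h3
  refine h3.congr' ?_
  filter_upwards [hn.eventually_gt_atTop 0] with k hk
  rw [Pi.div_apply, probCuts_eq _ _ _ hk, Polynomial.coe_one, one_mul, div_div_div_cancel_right₀]
  exact (mul_pos (negBinom_pos _ _) (ballotNum_zero_right_pos _)).ne'

lemma tendsto_altTheta {y : ℕ → ℝ} {q ρ : ℝ} (hρ : ρ < 1) (hy : ∀ k, 0 ≤ y k ∧ y k ≤ ρ)
    (h : Tendsto y atTop (𝓝 q)) : Tendsto (fun k => altTheta (y k)) atTop (𝓝 (altTheta q)) := by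
  have hρ0 : 0 ≤ ρ := (hy 0).1.trans (hy 0).2
  refine tendsto_tsum_of_dominated_convergence (summable_odd_mul_pow_choose hρ0 hρ)
    (fun j => (h.pow _).const_mul _) (Eventually.of_forall fun k j => ?_)
  rw [Real.norm_eq_abs, abs_mul, abs_pow, abs_neg, abs_one, one_pow, one_mul,
    abs_of_nonneg (pow_nonneg (hy k).1 _)]
  calc y k ^ (j + 1).choose 2 ≤ ρ ^ (j + 1).choose 2 := pow_le_pow_left₀ (hy k).1 (hy k).2 _
    _ ≤ _ := le_mul_of_one_le_left (by positivity)
      (by linarith [(Nat.cast_nonneg j : (0 : ℝ) ≤ j)])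

lemma exists_crossingRatio_le {m : ℕ → ℕ}
    (h : (fun n : ℕ => (m n : ℝ)) =O[atTop] (fun n : ℕ => (n : ℝ))) :
    ∃ ρ < 1, ∀ n, 0 < n → 0 ≤ crossingRatio n (m n) ∧ crossingRatio n (m n) ≤ ρ := by
  obtain ⟨C, hC, hb⟩ := bound_of_isBigO_nat_atTop h
  refine ⟨C / (C + 1), (div_lt_one (by linarith)).2 (by linarith), fun n hn => ⟨?_, ?_⟩⟩
  · unfold crossingRatio
    positivity
  · have hn' : (0 : ℝ) < n := by exact_mod_cast hn
    have h1 := hb hn'.ne'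
    simp only [Real.norm_natCast] at h1
    rw [crossingRatio, div_le_div_iff₀ (by positivity) (by linarith)]
    linarith

lemma cutParam_mem {x : ℝ} (hx0 : 0 ≤ x) (hx1 : x < 1) : 0 < cutParam x ∧ cutParam x < 1 := by
  have h1 := half_lt_altTheta hx0 hx1
  have h2 : 0 < (2 * altTheta x)⁻¹ := inv_pos.2 (by linarith)
  have h3 : (2 * altTheta x)⁻¹ < 1 := inv_lt_one_of_one_lt₀ (by linarith)
  rw [cutParam]
  constructor <;> linarith

lemma prod_geometricMeasure_real {s : unitInterval} (hs : s ≠ 0) (j : ℕ) :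
    ((geometricMeasure s).prod (geometricMeasure s)).real {y : ℕ × ℕ | y.1 + y.2 = j} =
      ((j : ℝ) + 1) * (s : ℝ) ^ 2 * (1 - s : ℝ) ^ j := by
  have h1 : {y : ℕ × ℕ | y.1 + y.2 = j} = (antidiagonal j : Finset (ℕ × ℕ)) := by
    ext y; simp
  have h2 : ∀ p : ℕ × ℕ, ((geometricMeasure s).prod (geometricMeasure s)).real {p} =
      ((1 - s : ℝ) ^ p.1 * s) * ((1 - s : ℝ) ^ p.2 * s) := by
    rintro ⟨a, b⟩
    rw [← Set.singleton_prod_singleton, measureReal_prod_prod,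
      geometricMeasure_real_singleton hs, geometricMeasure_real_singleton hs]
  rw [h1, ← sum_measureReal_singleton]
  simp only [h2]
  rw [sum_congr rfl (g := fun _ => (s : ℝ) ^ 2 * (1 - s : ℝ) ^ j) fun p hp => ?_]
  · simp
    ring
  · rw [← HasAntidiagonal.mem_antidiagonal.1 hp, pow_add]
    ring

end ChordCount

theorem mainTheorem6 :
    (∀ m : ℕ → ℕ, (fun n : ℕ => (m n : ℝ)) =O[atTop] (fun n : ℕ => (n : ℝ)) →
      (∃ δ : ℝ, 0 < δ ∧ ∀ n : ℕ, 1 ≤ n → 1 / 2 + δ ≤ altTheta (crossingRatio n (m n))) ∧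
      ∀ j : ℕ, (fun n : ℕ => probCuts n (m n) j -
          ((j : ℝ) + 1) * (1 - cutParam (crossingRatio n (m n))) ^ 2 *
            cutParam (crossingRatio n (m n)) ^ j) =o[atTop] (fun _ : ℕ => (1 : ℝ))) ∧
    (∀ x : ℝ, 0 ≤ x → x < 1 → 1 / 2 < altTheta x) ∧
    (∀ x : ℝ, 0 ≤ x → x < 1 →
      0 < cutParam x ∧ cutParam x < 1 ∧
      ∃ s : unitInterval, (s : ℝ) = 1 - cutParam x ∧ ∀ j : ℕ,
        ((geometricMeasure s).prod (geometricMeasure s)).real {y : ℕ × ℕ | y.1 + y.2 = j} =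
          ((j : ℝ) + 1) * (1 - cutParam x) ^ 2 * cutParam x ^ j) := by
  refine ⟨fun m hm => ?_, fun x hx0 hx1 => ChordCount.half_lt_altTheta hx0 hx1,
    fun x hx0 hx1 => ?_⟩
  · obtain ⟨ρ, hρ1, hρ⟩ := ChordCount.exists_crossingRatio_le hm
    -- This is half of `(1 - ρ) / 4`, the excess of `2 * altTheta` over `1`.
    refine ⟨⟨(1 - ρ) / 8, by linarith, fun n hn => ?_⟩, fun j => ?_⟩
    · have h1 := hρ n hn
      have h2 := ChordCount.one_add_le_two_mul_altTheta h1.1 (h1.2.trans_lt hρ1)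
      linarith
    · rw [isLittleO_one_iff]
      refine tendsto_of_subseq_tendsto fun ns hns => ?_
      -- The index `0` must be avoided: there the crossing ratio equals `1` as soon as `m 0 > 0`.
      obtain ⟨k₀, hk₀⟩ := (hns.eventually_gt_atTop 0).exists_forall_of_atTop
      have hb : ∀ k, crossingRatio (ns (k + k₀)) (m (ns (k + k₀))) ∈ Set.Icc 0 ρ :=
        fun k => hρ _ (hk₀ _ (by omega))
      obtain ⟨q, hq, φ, hφ, hlim⟩ := isCompact_Icc.tendsto_subseq hb
      refine ⟨fun k => φ k + k₀, ?_⟩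
      have hn : Tendsto (fun k => ns (φ k + k₀)) atTop atTop :=
        hns.comp (tendsto_atTop_mono (fun k => Nat.le_add_right _ _) hφ.tendsto_atTop)
      have hq1 : q < 1 := hq.2.trans_lt hρ1
      have h1 := ChordCount.tendsto_probCuts (m := fun k => m (ns (φ k + k₀))) hn hlim hq.1 hq1 j
      have h2 : Tendsto (fun k => cutParam
          (crossingRatio (ns (φ k + k₀)) (m (ns (φ k + k₀))))) atTop (𝓝 (cutParam q)) := by
        have h3 := ChordCount.tendsto_altTheta hρ1 (fun k => hb (φ k)) hlim
        have h4 := ChordCount.half_lt_altTheta hq.1 hq1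
        exact ((h3.const_mul 2).inv₀ (by linarith)).const_sub 1
      have h5 := h1.sub ((((h2.const_sub 1).pow 2).const_mul ((j : ℝ) + 1)).mul (h2.pow j))
      rwa [sub_self] at h5
  · have h1 := ChordCount.cutParam_mem hx0 hx1
    refine ⟨h1.1, h1.2, ⟨1 - cutParam x, by linarith, by linarith⟩, rfl, fun j => ?_⟩
    rw [ChordCount.prod_geometricMeasure_real]
    · simp
    · intro h
      have := congrArg Subtype.val h
      simp only [Set.Icc.coe_zero] at this
      linarith
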